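/- Let $p,u,v,w\in\mathbb R^3$, $\pi=\{(x_1,x_2):0<x_1<1,\ 0<x_2<x_1\}$, $\chi_\tau(y)=p+y_1v+y_2u$, $\chi_\sigma(x)=p+x_1v+x_2w$, $\tau=\chi_\tau(\pi)$, $\sigma=\chi_\sigma(\pi)$, with Gram determinants $g_\tau=\sqrt{|v|^2|u|^2-(v\cdot u)^2}\neq0$ and $g_\sigma=\sqrt{|v|^2|w|^2-(v\cdot w)^2}\ne0$. Assume that the closed triangles intersect exactly in their common edge, $\bar\sigma\cap\bar\tau=[p,p+v]$. Let $n$ be a unit normal of $\tau$, let $\varphi(\chi_\tau(y))=a_0+a_1y_1+a_2y_2$ for $y\in\pi$, and put $c_0=a_0/2+a_1/3$, $c_1=-a_1/6$, $c_2=a_2/6$. Let $$J=\int_\sigma\int_\tau\frac{(x-y)\cdot n}{4\pi|x-y|^3}\,\varphi(y)\,dS(y)\,dS(x).$$ **(1)** The integrand of $J$ is absolutely integrable over $\sigma\times\tau$, the integrands of the $J_i$ below are absolutely integrable over $(0,1)^2$, and $$J=\frac{g_\sigma g_\tau}{4\pi}\,(w\cdot n)\sum_{i=1}^5J_i,$$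 where, all integrals being over $(\eta_3,\eta_4)\in(0,1)^2$, $$J_1=\int\frac{\eta_4\,(c_0+c_1\eta_3+c_2(1-\eta_3))}{|\eta_3(u+v)+\eta_4w-u|^3},\qquad J_2=\int\frac{\eta_3\,(c_0+c_1\eta_3\eta_4+c_2\eta_3(1-\eta_4))}{|\eta_3\eta_4(u+v)-\eta_3u+w|^3},$$ $$J_3=\int\frac{\eta_3^2(1-\eta_4)(c_0+c_2)}{|\eta_3\eta_4(w+v)-\eta_3w+u|^3},\qquad J_4=\int\frac{\eta_3(1-\eta_3)(c_0+c_2\eta_3\eta_4)}{|\eta_3\eta_4u+\eta_3(w+v)-w|^3},$$ $$J_5=\int\frac{\eta_3(1-\eta_3\eta_4)(c_0+c_2\eta_3)}{|\eta_3\eta_4(w+v)+\eta_3u-w|^3}.$$ If the triangles lie in one plane ($w\cdot n=0$), then $J=0$. **(2)** Suppose $w\cdot n\neq0$. For $i=1,\dots,5$ and $j=0,1$ let $$h^{(i)}_j=\frac{4P}{D\sqrt Q},\quad P=p_0+p_1\eta+p_2\eta^2+p_3\eta^3,\quad Q=q(q_0+q_1\eta+\eta^2),\quad D=4d(d_0+d_1\eta+\eta^2),$$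 with the following parameters ($d,d_0,d_1$ depend only on $i$), where $s=u+v$, $r=v+w$, $a=u+v+w$, $C=c_0+c_2$, $e=c_2-c_1$, and $\Delta(x,y)=|x|^2|y|^2-(x\cdot y)^2$. $$\begin{array}{c|ccc} (i,j)&q&q\,q_0&\tfrac12q\,q_1\\\hline (1,0)&|s|^2&|u|^2&-s\cdot u\\ (1,1)&|s|^2&|u-w|^2&-s\cdot(u-w)\\ (2,0)&|u|^2&|w|^2&-u\cdot w\\ (2,1)&|v|^2&|w|^2&v\cdot w\\ (3,0)&|w|^2&|u|^2&-u\cdot w\\ (3,1)&|v|^2&|u|^2&u\cdot v\\ (4,0)&|r|^2&|w|^2&-r\cdot w\\ (4,1)&|a|^2&|w|^2&-a\cdot w\\ (5,0)&|u|^2&|w|^2&-u\cdot w\\ (5,1)&|a|^2&|w|^2&-a\cdot w \end{array} \qquad \begin{array}{c|ccc} i&d&d\,d_0&\tfrac12d\,d_1\\\hline 1&\Delta(s,w)&\Delta(u,w)&(u\cdot w)(s\cdot w)-|w|^2\,s\cdot u\\ 2&\Delta(u,v)&\Delta(s,w)&(v\cdot w)(s\cdot u)-(u\cdot w)(s\cdot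 v)\\ 3&\Delta(v,w)&\Delta(r,u)&(u\cdot v)(r\cdot w)-(u\cdot w)(r\cdot v)\\ 4&\Delta(u,r)&\Delta(u,w)&(u\cdot w)(r\cdot u)-|u|^2\,r\cdot w\\ 5&\Delta(u,r)&\Delta(v,w)&(u\cdot v)(r\cdot w)-(u\cdot w)(r\cdot v) \end{array}$$ The coefficients $(p_0;\,p_1;\,p_2;\,p_3)$ are - $(1,0)$: $-C|u|^2$; $(2c_0-c_1+3c_2)|u|^2+2C\,u\cdot v$; $(2c_1-c_0-3c_2)|u|^2-C|v|^2+2(c_1-c_0-2c_2)\,u\cdot v$; $e|s|^2$. - $(1,1)$: $C(w-u)\cdot u$; $2C\,u\cdot v-C\,v\cdot w+(2c_0-c_1+3c_2)|u|^2+(c_1-c_0-2c_2)\,u\cdot w$; $(2c_1-c_0-3c_2)|u|^2-C|v|^2+2(c_1-c_0-2c_2)\,u\cdot v+e\,s\cdot w$; $e|s|^2$. - $(2,0)$: $c_0\,s\cdot w+e|w|^2$; $(2c_1-c_2)\,u\cdot w+c_2\,v\cdot w-c_0\,s\cdot u$; $-(c_1|u|^2+c_2\,u\cdot v)$; $0$.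 - $(2,1)$: $c_0\,s\cdot w+e|w|^2$; $(2c_2-c_1)\,v\cdot w+c_1\,u\cdot w+c_0\,s\cdot v$; $c_2|v|^2+c_1\,u\cdot v$; $0$. - $(3,0)$: $C|u|^2$; $C(v-w)\cdot u$; $-C\,v\cdot w$; $0$. - $(3,1)$: $C|u|^2$; $2C\,u\cdot v$; $C|v|^2$; $0$. - $(4,0)$: $-c_0\,u\cdot w-c_2|w|^2$; $c_0(v+2w)\cdot u+c_2(2v+3w)\cdot w$; $-c_0\,r\cdot u-c_2(|r|^2+2r\cdot w)$; $c_2|r|^2$. - $(4,1)$: $-c_0\,u\cdot w-c_2|w|^2$; $c_0\,s\cdot u+(2c_0+c_2)\,u\cdot w+c_2(2v+3w)\cdot w$; $-c_0\,a\cdot u-c_2\,u\cdot v-c_2|r|^2-2c_2\,a\cdot w$; $c_2\,r\cdot u+c_2|r|^2$. - $(5,0)$: $-c_0\,v\cdot w$; $c_0(v-w)\cdot u-c_2\,v\cdot w$; $c_0|u|^2+c_2(v-w)\cdot u$; $c_2|u|^2$. - $(5,1)$: $-c_0\,v\cdot w$; $c_0\,s\cdot v-c_2\,v\cdot w+c_0(v-u)\cdot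 w$; $c_0\,a\cdot u+c_2(s\cdot v+(v-u)\cdot w)$; $c_2\,a\cdot u$. For every $i$, integrating the integrand of $J_i$ over $\eta_4\in(0,1)$ gives $h^{(i)}_1(\eta_3)-h^{(i)}_0(\eta_3)$ for every $\eta_3\in[0,1]$, and $$J_i=\int_0^1h^{(i)}_1(\eta)\,d\eta-\int_0^1h^{(i)}_0(\eta)\,d\eta .$$ **(3)** Suppose $w\cdot n\ne0$ and let $h=h^{(i)}_j$ be any of these ten functions. Then $q>0$, $d>0$, $Q>0$ and $D>0$ on $\mathbb R$, $h$ is integrable on $(0,1)$, and with $N=p_0-d_0p_2+d_0d_1p_3$, $M=p_1-d_1p_2-d_0p_3+d_1^2p_3$, $$h(\eta)=\frac1{d\sqrt{Q(\eta)}}\Bigl(p_2-d_1p_3+p_3\eta+\frac{N+M\eta}{d_0+d_1\eta+\eta^2}\Bigr).$$ Moreover $$\int_0^1h\,d\eta=\frac1{d\sqrt q}\Bigl(\Bigl[p_3\sqrt{q_0+q_1\eta+\eta^2}+\bigl(p_2-d_1p_3-\tfrac{p_3q_1}2\bigr)F(\eta)\Bigr]_0^1+T\Bigr),$$ with $F(\eta)=\ln\bigl(2\sqrt{q_0+q_1\eta+\eta^2}+2\eta+q_1\bigr)$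 and $T$ given as follows. Put $$G(\rho,s)=\begin{cases}\arctan(s/\sqrt\rho)/\sqrt\rho,&\rho>0,\\-1/s,&\rho=0,\\\frac1{2\sqrt{-\rho}}\ln\Bigl|\frac{s-\sqrt{-\rho}}{s+\sqrt{-\rho}}\Bigr|,&\rho<0,\end{cases}\qquad G(\rho,\infty)=\begin{cases}\frac{\pi}{2\sqrt\rho},&\rho>0,\\0,&\rho\le0.\end{cases}$$ *Case $d_1\neq q_1$.* The equation $(d_1-q_1)z^2+2(d_0-q_0)z+(q_1d_0-d_1q_0)=0$ has exactly two real solutions $\nu<\mu$. Put $$\omega=\frac{\mu-\nu}{(\mu^2+d_1\mu+d_0)\sqrt{\mu^2+q_1\mu+q_0}},\quad\lambda=\frac{\nu^2+d_1\nu+d_0}{\mu^2+d_1\mu+d_0},\quad\varkappa=\frac{\nu^2+q_1\nu+q_0}{\mu^2+q_1\mu+q_0},$$ $$s_0(t)=\frac t{\sqrt{\varkappa+t^2}},\qquad s_1(t)=\sqrt{\varkappa+t^2},$$ $$H(t)=\omega\,\mathrm{sgn}(1+t)\Bigl[\tfrac{N+M\nu}{\varkappa-\lambda}G\bigl(\tfrac{\lambda}{\varkappa-\lambda},s_0(t)\bigr)+(N+M\mu)\,G(\lambda-\varkappa,s_1(t))\Bigr].$$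 For every real $\eta\neq\mu$ the function $\eta\mapsto H\bigl(\frac{\nu-\eta}{\eta-\mu}\bigr)$ has derivative $\dfrac{N+M\eta}{(d_0+d_1\eta+\eta^2)\sqrt{q_0+q_1\eta+\eta^2}}$, and $$\lim_{t\to\pm\infty}H(t)=H(\pm\infty):=\pm\omega\Bigl[\tfrac{N+M\nu}{\varkappa-\lambda}G\bigl(\tfrac\lambda{\varkappa-\lambda},\pm1\bigr)+(N+M\mu)\,G(\lambda-\varkappa,\infty)\Bigr].$$ If $\mu\notin\{0,1\}$, let $t_0$ and $t_1$ be the minimum and the maximum of $-\frac\nu\mu$ and $-\frac{\nu-1}{\mu-1}$. Then exactly one of the following two alternatives holds, and $$T=\begin{cases}H(t_1)-H(t_0),&t_0>-1\text{ or }t_1<-1,\\H(t_0)-H(-\infty)+H(\infty)-H(t_1),&t_0<-1<t_1.\end{cases}$$ If $\mu=0$, then $T=H(\nu-1)-H(-\infty)$. If $\mu=1$, then $T=H(\infty)-H(-\nu)$. *Case $d_1=q_1$.* With $\lambda=d_0-d_1^2/4$, $\varkappa=q_0-q_1^2/4$, and $s_0,s_1$ formed with this $\varkappa$, one has $T=H(1+\tfrac{q_1}2)-H(\tfrac{q_1}2)$,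 where $$H(t)=\begin{cases}\dfrac{N-Mq_1/2}{\varkappa-\lambda}\,G\bigl(\tfrac\lambda{\varkappa-\lambda},s_0(t)\bigr)+M\,G(\lambda-\varkappa,s_1(t)),&d_0\neq q_0,\\[2ex]\dfrac{N-Mq_1/2}{\varkappa}\,s_0(t)+M\,G(0,s_1(t)),&d_0=q_0.\end{cases}$$ -/

import Mathlib

open MeasureTheory Set Filter Topology
open scoped RealInnerProductSpace

noncomputable section

namespace DoubleLayer

/-- Euclidean three-space. -/
abbrev E3 : Type := EuclideanSpace ℝ (Fin 3)

/-- The reference triangle `{(x₁, x₂) | 0 < x₁ < 1, 0 < x₂ < x₁}`. -/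
def refTriangle : Set (ℝ × ℝ) := {x | 0 < x.1 ∧ x.1 < 1 ∧ 0 < x.2 ∧ x.2 < x.1}

/-- The affine reference mapping `(x₁, x₂) ↦ p + x₁ a + x₂ b`. -/
def chart (p a b : E3) (x : ℝ × ℝ) : E3 := p + x.1 • a + x.2 • b

/-- The open flat triangle parametrised by `chart p a b`; its vertices are `p`, `p + a` and
`p + a + b`. -/
def triangle (p a b : E3) : Set E3 := chart p a b '' refTriangle

/-- The Gram determinant `√(det (Jᵀ J))` of `chart p a b`, where `J = (a | b)`. -/
def gramDet (a b : E3) : ℝ := √(Matrix.gram ℝ ![a, b]).det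

/-- The double layer kernel `(x - y) · n / (4π |x - y|³)`. -/
def kernel (n x y : E3) : ℝ := ⟪x - y, n⟫ / (4 * Real.pi * ‖x - y‖ ^ 3)

/-- The double layer integral over `x ∈ σ`, `y ∈ τ` with respect to surface measure. -/
def doubleLayerIntegral (σ τ : Set E3) (n : E3) (φ : E3 → ℝ) : ℝ :=
  ∫ x in σ, ∫ y in τ, kernel n x y * φ y ∂(μHE[2]) ∂(μHE[2])

/-- The five regularised integrands, as functions of `η = (η₃, η₄)`; the index `i : Fin 5`
stands for the integral number `i + 1`. -/
def edgeIntegrand (u v w : E3) (c₀ c₁ c₂ : ℝ) (i : Fin 5) (η : ℝ × ℝ) : ℝ :=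
  ![η.2 / ‖η.1 • (u + v) + η.2 • w - u‖ ^ 3 * (c₀ + c₁ * η.1 + c₂ * (1 - η.1)),
    η.1 / ‖(η.1 * η.2) • (u + v) - η.1 • u + w‖ ^ 3
      * (c₀ + c₁ * (η.1 * η.2) + c₂ * (η.1 * (1 - η.2))),
    η.1 ^ 2 * (1 - η.2) / ‖(η.1 * η.2) • (w + v) - η.1 • w + u‖ ^ 3 * (c₀ + c₂),
    η.1 * (1 - η.1) / ‖(η.1 * η.2) • u + η.1 • (w + v) - w‖ ^ 3 * (c₀ + c₂ * (η.1 * η.2)),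
    η.1 * (1 - η.1 * η.2) / ‖(η.1 * η.2) • (w + v) + η.1 • u - w‖ ^ 3 * (c₀ + c₂ * η.1)] i

/-- The integrals `J₁, …, J₅` over the open unit square. -/
def edgeIntegral (u v w : E3) (c₀ c₁ c₂ : ℝ) (i : Fin 5) : ℝ :=
  ∫ η in Ioo (0 : ℝ) 1 ×ˢ Ioo (0 : ℝ) 1, edgeIntegrand u v w c₀ c₁ c₂ i η

/-- The parameters of an integrand `4 P / (D √Q)`. -/
structure Params where
  (q q₀ q₁ d d₀ d₁ p₀ p₁ p₂ p₃ : ℝ)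

namespace Params

variable (S : Params)

/-- `P(η) = p₀ + p₁ η + p₂ η² + p₃ η³`. -/
def P (η : ℝ) : ℝ := S.p₀ + S.p₁ * η + S.p₂ * η ^ 2 + S.p₃ * η ^ 3

/-- The monic quadratic `q₀ + q₁ η + η²`. -/
def Qm (η : ℝ) : ℝ := S.q₀ + S.q₁ * η + η ^ 2

/-- `Q(η) = q (q₀ + q₁ η + η²)`. -/
def Q (η : ℝ) : ℝ := S.q * S.Qm η

/-- The monic quadratic `d₀ + d₁ η + η²`. -/
def Dm (η : ℝ) : ℝ := S.d₀ + S.d₁ * η + η ^ 2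

/-- `D(η) = 4 d (d₀ + d₁ η + η²)`. -/
def D (η : ℝ) : ℝ := 4 * S.d * S.Dm η

/-- `h = 4 P / (D √Q)`. -/
def h (η : ℝ) : ℝ := 4 * S.P η / (S.D η * √(S.Q η))

/-- `F(η) = ln (2 √(q₀ + q₁ η + η²) + 2 η + q₁)`. -/
def F (η : ℝ) : ℝ := Real.log (2 * √(S.Qm η) + 2 * η + S.q₁)

/-- The elementary part of the antiderivative. -/
def E (η : ℝ) : ℝ :=
  S.p₃ * √(S.Qm η) + (S.p₂ - S.d₁ * S.p₃ - S.p₃ * S.q₁ / 2) * S.F η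

/-- Constant coefficient of the remainder in the partial fraction decomposition. -/
def n : ℝ := S.p₀ - S.d₀ * S.p₂ + S.d₀ * S.d₁ * S.p₃

/-- Linear coefficient of the remainder in the partial fraction decomposition. -/
def m : ℝ := S.p₁ - S.d₁ * S.p₂ - S.d₀ * S.p₃ + S.d₁ ^ 2 * S.p₃

end Params

/-- The antiderivative `G(ρ, s)` of `1 / (ρ + s²)`. -/
def G (ρ s : ℝ) : ℝ :=
  if 0 < ρ then Real.arctan (s / √ρ) / √ρ
  else if ρ = 0 then -1 / s
  else 1 / (2 * √(-ρ)) * Real.log |(s - √(-ρ)) / (s + √(-ρ))|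

/-- The limit of `G(ρ, s)` as `s → ∞`. -/
def GInfty (ρ : ℝ) : ℝ := if 0 < ρ then Real.pi / (2 * √ρ) else 0

/-- `s₀(t) = t / √(ϰ + t²)`. -/
def s₀ (ϰ t : ℝ) : ℝ := t / √(ϰ + t ^ 2)

/-- `s₁(t) = √(ϰ + t²)`. -/
def s₁ (ϰ t : ℝ) : ℝ := √(ϰ + t ^ 2)

/-- The inverse `t = (ν - η) / (η - μ)` of the substitution `η = (ν + μ t) / (1 + t)`. -/
def subst (ν μ η : ℝ) : ℝ := (ν - η) / (η - μ)

namespace Params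

variable (S : Params)

/-- `ω = (μ - ν) / ((μ² + d₁ μ + d₀) √(μ² + q₁ μ + q₀))`. -/
def omega (ν μ : ℝ) : ℝ := (μ - ν) / (S.Dm μ * √(S.Qm μ))

/-- `λ = (ν² + d₁ ν + d₀) / (μ² + d₁ μ + d₀)`. -/
def lam (ν μ : ℝ) : ℝ := S.Dm ν / S.Dm μ

/-- `ϰ = (ν² + q₁ ν + q₀) / (μ² + q₁ μ + q₀)`. -/
def kap (ν μ : ℝ) : ℝ := S.Qm ν / S.Qm μ

/-- The antiderivative `H(t)` produced by the fractional linear substitution. -/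
def H (ν μ t : ℝ) : ℝ :=
  S.omega ν μ * SignType.sign (1 + t) *
    ((S.n + S.m * ν) / (S.kap ν μ - S.lam ν μ) *
        G (S.lam ν μ / (S.kap ν μ - S.lam ν μ)) (s₀ (S.kap ν μ) t)
      + (S.n + S.m * μ) * G (S.lam ν μ - S.kap ν μ) (s₁ (S.kap ν μ) t))

/-- The closed form of the limit of `H(t)` as `t → ∞`. -/
def HTop (ν μ : ℝ) : ℝ :=
  S.omega ν μ *
    ((S.n + S.m * ν) / (S.kap ν μ - S.lam ν μ) * G (S.lam ν μ / (S.kap ν μ - S.lam ν μ)) 1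
      + (S.n + S.m * μ) * GInfty (S.lam ν μ - S.kap ν μ))

/-- The closed form of the limit of `H(t)` as `t → -∞`. -/
def HBot (ν μ : ℝ) : ℝ :=
  -S.omega ν μ *
    ((S.n + S.m * ν) / (S.kap ν μ - S.lam ν μ) * G (S.lam ν μ / (S.kap ν μ - S.lam ν μ)) (-1)
      + (S.n + S.m * μ) * GInfty (S.lam ν μ - S.kap ν μ))

/-- `d₀ - d₁² / 4`, the role of `λ` after the shift `η = t - q₁ / 2` when `d₁ = q₁`. -/
def lamShift : ℝ := S.d₀ - S.d₁ ^ 2 / 4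

/-- `q₀ - q₁² / 4`, the role of `ϰ` after the shift `η = t - q₁ / 2` when `d₁ = q₁`. -/
def kapShift : ℝ := S.q₀ - S.q₁ ^ 2 / 4

/-- The antiderivative in the shifted variable when `d₁ = q₁` and `d₀ ≠ q₀`. -/
def HShift (t : ℝ) : ℝ :=
  (S.n - S.m * S.q₁ / 2) / (S.kapShift - S.lamShift) *
      G (S.lamShift / (S.kapShift - S.lamShift)) (s₀ S.kapShift t)
    + S.m * G (S.lamShift - S.kapShift) (s₁ S.kapShift t)

/-- The antiderivative in the shifted variable when `d₁ = q₁` and `d₀ = q₀`. -/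
def HProp (t : ℝ) : ℝ :=
  (S.n - S.m * S.q₁ / 2) / S.kapShift * s₀ S.kapShift t + S.m * G 0 (s₁ S.kapShift t)

end Params

/-- Table of `q`; rows are `i = 1, …, 5`, columns are `j = 0, 1`. -/
def tabQ (u v w : E3) : Fin 5 → Fin 2 → ℝ :=
  ![![‖u + v‖ ^ 2, ‖u + v‖ ^ 2],
    ![‖u‖ ^ 2, ‖v‖ ^ 2],
    ![‖w‖ ^ 2, ‖v‖ ^ 2],
    ![‖v + w‖ ^ 2, ‖u + v + w‖ ^ 2],
    ![‖u‖ ^ 2, ‖u + v + w‖ ^ 2]]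

/-- Table of `q q₀`. -/
def tabQ₀ (u w : E3) : Fin 5 → Fin 2 → ℝ :=
  ![![‖u‖ ^ 2, ‖u - w‖ ^ 2],
    ![‖w‖ ^ 2, ‖w‖ ^ 2],
    ![‖u‖ ^ 2, ‖u‖ ^ 2],
    ![‖w‖ ^ 2, ‖w‖ ^ 2],
    ![‖w‖ ^ 2, ‖w‖ ^ 2]]

/-- Table of `q q₁ / 2`. -/
def tabQ₁ (u v w : E3) : Fin 5 → Fin 2 → ℝ :=
  ![![-⟪u + v, u⟫, -⟪u + v, u - w⟫],
    ![-⟪u, w⟫, ⟪v, w⟫],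
    ![-⟪u, w⟫, ⟪u, v⟫],
    ![-⟪v + w, w⟫, -⟪u + v + w, w⟫],
    ![-⟪u, w⟫, -⟪u + v + w, w⟫]]

/-- Table of `d`; it does not depend on `j`. -/
def tabD (u v w : E3) : Fin 5 → ℝ :=
  ![‖u + v‖ ^ 2 * ‖w‖ ^ 2 - ⟪u + v, w⟫ ^ 2,
    ‖u‖ ^ 2 * ‖v‖ ^ 2 - ⟪u, v⟫ ^ 2,
    ‖v‖ ^ 2 * ‖w‖ ^ 2 - ⟪v, w⟫ ^ 2,
    ‖u‖ ^ 2 * ‖v + w‖ ^ 2 - ⟪v + w, u⟫ ^ 2,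
    ‖u‖ ^ 2 * ‖v + w‖ ^ 2 - ⟪v + w, u⟫ ^ 2]

/-- Table of `d d₀`. -/
def tabD₀ (u v w : E3) : Fin 5 → ℝ :=
  ![‖u‖ ^ 2 * ‖w‖ ^ 2 - ⟪u, w⟫ ^ 2,
    ‖u + v‖ ^ 2 * ‖w‖ ^ 2 - ⟪u + v, w⟫ ^ 2,
    ‖v + w‖ ^ 2 * ‖u‖ ^ 2 - ⟪v + w, u⟫ ^ 2,
    ‖u‖ ^ 2 * ‖w‖ ^ 2 - ⟪u, w⟫ ^ 2,
    ‖v‖ ^ 2 * ‖w‖ ^ 2 - ⟪v, w⟫ ^ 2]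

/-- Table of `d d₁ / 2`. -/
def tabD₁ (u v w : E3) : Fin 5 → ℝ :=
  ![⟪u, w⟫ * ⟪u + v, w⟫ - ‖w‖ ^ 2 * ⟪u + v, u⟫,
    ⟪v, w⟫ * ⟪u + v, u⟫ - ⟪u, w⟫ * ⟪u + v, v⟫,
    ⟪u, v⟫ * ⟪v + w, w⟫ - ⟪u, w⟫ * ⟪v + w, v⟫,
    ⟪u, w⟫ * ⟪v + w, u⟫ - ‖u‖ ^ 2 * ⟪v + w, w⟫,
    ⟪u, v⟫ * ⟪v + w, w⟫ - ⟪u, w⟫ * ⟪v + w, v⟫]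

/-- Table of `p₀`. -/
def tabP₀ (u v w : E3) (c₀ c₁ c₂ : ℝ) : Fin 5 → Fin 2 → ℝ :=
  ![![-(c₀ + c₂) * ‖u‖ ^ 2, (c₀ + c₂) * ⟪w - u, u⟫],
    ![c₀ * ⟪u + v, w⟫ + (c₂ - c₁) * ‖w‖ ^ 2, c₀ * ⟪u + v, w⟫ + (c₂ - c₁) * ‖w‖ ^ 2],
    ![(c₀ + c₂) * ‖u‖ ^ 2, (c₀ + c₂) * ‖u‖ ^ 2],
    ![-c₀ * ⟪u, w⟫ - c₂ * ‖w‖ ^ 2, -c₀ * ⟪u, w⟫ - c₂ * ‖w‖ ^ 2],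
    ![-c₀ * ⟪v, w⟫, -c₀ * ⟪v, w⟫]]

/-- Table of `p₁`. -/
def tabP₁ (u v w : E3) (c₀ c₁ c₂ : ℝ) : Fin 5 → Fin 2 → ℝ :=
  ![![(2 * c₀ - c₁ + 3 * c₂) * ‖u‖ ^ 2 + 2 * (c₀ + c₂) * ⟪u, v⟫,
      2 * (c₀ + c₂) * ⟪u, v⟫ - (c₀ + c₂) * ⟪v, w⟫ + (2 * c₀ - c₁ + 3 * c₂) * ‖u‖ ^ 2
        + (c₁ - c₀ - 2 * c₂) * ⟪u, w⟫],
    ![(2 * c₁ - c₂) * ⟪u, w⟫ + c₂ * ⟪v, w⟫ - c₀ * ⟪u + v, u⟫,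
      (2 * c₂ - c₁) * ⟪v, w⟫ + c₁ * ⟪u, w⟫ + c₀ * ⟪u + v, v⟫],
    ![(c₀ + c₂) * ⟪v - w, u⟫, 2 * (c₀ + c₂) * ⟪u, v⟫],
    ![c₀ * ⟪v + (2 : ℝ) • w, u⟫ + c₂ * ⟪(2 : ℝ) • v + (3 : ℝ) • w, w⟫,
      c₀ * ⟪u + v, u⟫ + (2 * c₀ + c₂) * ⟪u, w⟫ + c₂ * ⟪(2 : ℝ) • v + (3 : ℝ) • w, w⟫],
    ![c₀ * ⟪v - w, u⟫ - c₂ * ⟪v, w⟫,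
      c₀ * ⟪u + v, v⟫ - c₂ * ⟪v, w⟫ + c₀ * ⟪v - u, w⟫]]

/-- Table of `p₂`. -/
def tabP₂ (u v w : E3) (c₀ c₁ c₂ : ℝ) : Fin 5 → Fin 2 → ℝ :=
  ![![(2 * c₁ - c₀ - 3 * c₂) * ‖u‖ ^ 2 - (c₀ + c₂) * ‖v‖ ^ 2
        + 2 * (c₁ - c₀ - 2 * c₂) * ⟪u, v⟫,
      (2 * c₁ - c₀ - 3 * c₂) * ‖u‖ ^ 2 - (c₀ + c₂) * ‖v‖ ^ 2
        + 2 * (c₁ - c₀ - 2 * c₂) * ⟪u, v⟫ + (c₂ - c₁) * ⟪u + v, w⟫],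
    ![-(c₁ * ‖u‖ ^ 2 + c₂ * ⟪u, v⟫), c₂ * ‖v‖ ^ 2 + c₁ * ⟪u, v⟫],
    ![-(c₀ + c₂) * ⟪v, w⟫, (c₀ + c₂) * ‖v‖ ^ 2],
    ![-c₀ * ⟪v + w, u⟫ - c₂ * (‖v + w‖ ^ 2 + 2 * ⟪v + w, w⟫),
      -c₀ * ⟪u + v + w, u⟫ - c₂ * ⟪u, v⟫ - c₂ * ‖v + w‖ ^ 2 - 2 * c₂ * ⟪u + v + w, w⟫],
    ![c₀ * ‖u‖ ^ 2 + c₂ * ⟪v - w, u⟫,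
      c₀ * ⟪u + v + w, u⟫ + c₂ * (⟪u + v, v⟫ + ⟪v - u, w⟫)]]

/-- Table of `p₃`. -/
def tabP₃ (u v w : E3) (c₁ c₂ : ℝ) : Fin 5 → Fin 2 → ℝ :=
  ![![(c₂ - c₁) * ‖u + v‖ ^ 2, (c₂ - c₁) * ‖u + v‖ ^ 2],
    ![0, 0],
    ![0, 0],
    ![c₂ * ‖v + w‖ ^ 2, c₂ * ⟪v + w, u⟫ + c₂ * ‖v + w‖ ^ 2],
    ![c₂ * ‖u‖ ^ 2, c₂ * ⟪u + v + w, u⟫]]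

/-- The parameters of the `j`-th integrand `h` belonging to the integral number `i + 1`. -/
def edgeParams (u v w : E3) (c₀ c₁ c₂ : ℝ) (i : Fin 5) (j : Fin 2) : Params where
  q := tabQ u v w i j
  q₀ := tabQ₀ u w i j / tabQ u v w i j
  q₁ := 2 * tabQ₁ u v w i j / tabQ u v w i j
  d := tabD u v w i
  d₀ := tabD₀ u v w i / tabD u v w i
  d₁ := 2 * tabD₁ u v w i / tabD u v w i
  p₀ := tabP₀ u v w c₀ c₁ c₂ i j
  p₁ := tabP₁ u v w c₀ c₁ c₂ i j
  p₂ := tabP₂ u v w c₀ c₁ c₂ i j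
  p₃ := tabP₃ u v w c₁ c₂ i j

end DoubleLayer

end

/-!
Relative coordinates adapted to the common edge split the pairs of points of the two triangles into
five four-dimensional regions, on each of which Duffy coordinates turn the kernel into a power of
the two outer variables times a function of the two inner ones. The outer variables integrate out
to the moments `c₀`, `c₁`, `c₂` of the density and leave regular integrals over the unit square.

Every slice of these integrals is a line integral of `(a + b x) / ‖x • A + B‖ ^ 3`, which has an
elementary primitive whose boundary values are the functions `h`. Partial fractions split off an
elementary part of `h`; what remains is a linear polynomial over `D √Q` with quadratics `D` and `Q`.
There is a pair of points `ν < μ` conjugate with respect to both quadratics (the roots of their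
Jacobian), and in the projective coordinate `t = (ν - η) / (η - μ)` both lose their linear term, so
that the substitutions `t / √(ϰ + t²)` and `√(ϰ + t²)` give rational integrands. If the linear terms
of the two quadratics agree, a shift takes the place of the projective coordinate.
-/

noncomputable section

namespace DoubleLayer

open scoped ENNReal

/-! ### The rational-quadratic primitive -/

theorem G_sq {r : ℝ} (hr : 0 < r) (s : ℝ) : G (r ^ 2) s = Real.arctan (s / r) / r := by
  rw [G, if_pos (by positivity), Real.sqrt_sq hr.le]

theorem G_zero (s : ℝ) : G 0 s = -1 / s := by
  rw [G, if_neg (lt_irrefl 0), if_pos rfl]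

theorem G_neg_sq {r : ℝ} (hr : 0 < r) (s : ℝ) :
    G (-r ^ 2) s = 1 / (2 * r) * Real.log ((s - r) / (s + r)) := by
  have hr2 : -r ^ 2 < 0 := neg_lt_zero.2 (by positivity)
  rw [G, if_neg hr2.not_gt, if_neg hr2.ne, neg_neg, Real.sqrt_sq hr.le, Real.log_abs]

theorem exists_eq_sq_or_eq_zero_or_exists_eq_neg_sq (ρ : ℝ) :
    (∃ r > 0, ρ = r ^ 2) ∨ ρ = 0 ∨ ∃ r > 0, ρ = -r ^ 2 := by
  rcases lt_trichotomy 0 ρ with hρ | hρ | hρ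
  · exact Or.inl ⟨√ρ, Real.sqrt_pos.2 hρ, (Real.sq_sqrt hρ.le).symm⟩
  · exact Or.inr (Or.inl hρ.symm)
  · have hρ' : 0 < -ρ := neg_pos.2 hρ
    exact Or.inr (Or.inr ⟨√(-ρ), Real.sqrt_pos.2 hρ', by rw [Real.sq_sqrt hρ'.le, neg_neg]⟩)

theorem hasDerivAt_G {ρ s : ℝ} (h : ρ + s ^ 2 ≠ 0) : HasDerivAt (G ρ) (1 / (ρ + s ^ 2)) s := by
  obtain ⟨r, hr, rfl⟩ | rfl | ⟨r, hr, rfl⟩ := exists_eq_sq_or_eq_zero_or_exists_eq_neg_sq ρ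
  · rw [funext (G_sq hr)]
    refine (((hasDerivAt_id' s).div_const r).arctan.div_const r).congr_deriv ?_
    field_simp
  · rw [funext G_zero]
    have hs : s ≠ 0 := by simpa using h
    refine ((hasDerivAt_const s (-1 : ℝ)).fun_div (hasDerivAt_id' s) hs).congr_deriv ?_
    simp
  · rw [funext (G_neg_sq hr)]
    have hfac : (s - r) * (s + r) = -r ^ 2 + s ^ 2 := by ring
    rw [← hfac] at h ⊢
    have hsub := left_ne_zero_of_mul h
    have hadd := right_ne_zero_of_mul h
    refine (((((hasDerivAt_id' s).sub_const r).fun_div ((hasDerivAt_id' s).add_const r)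
      hadd).log (div_ne_zero hsub hadd)).const_mul (1 / (2 * r))).congr_deriv ?_
    field_simp
    ring

theorem tendsto_G_atTop (ρ : ℝ) : Tendsto (G ρ) atTop (𝓝 (GInfty ρ)) := by
  obtain ⟨r, hr, rfl⟩ | rfl | ⟨r, hr, rfl⟩ := exists_eq_sq_or_eq_zero_or_exists_eq_neg_sq ρ
  · have hlim : GInfty (r ^ 2) = Real.pi / 2 / r := by
      rw [GInfty, if_pos (by positivity), Real.sqrt_sq hr.le, div_div]
    rw [funext (G_sq hr), hlim]
    exact ((Real.tendsto_arctan_atTop.mono_right nhdsWithin_le_nhds).comp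
      (tendsto_id.atTop_div_const hr)).div_const r
  · rw [funext G_zero, GInfty, if_neg (lt_irrefl 0)]
    exact tendsto_const_nhds.div_atTop tendsto_id
  · have hlim : GInfty (-r ^ 2) = 1 / (2 * r) * Real.log (1 - 0) := by
      rw [GInfty, if_neg (neg_nonpos.2 (sq_nonneg r)).not_gt, sub_zero, Real.log_one, mul_zero]
    have hquot : Tendsto (fun s : ℝ => 1 - 2 * r / (s + r)) atTop (𝓝 (1 - 0)) :=
      tendsto_const_nhds.sub (tendsto_const_nhds.div_atTop
        (tendsto_atTop_add_const_right _ _ tendsto_id))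
    rw [funext (G_neg_sq hr), hlim]
    refine ((hquot.congr' ?_).log (by norm_num)).const_mul _
    filter_upwards [eventually_gt_atTop (-r)] with s hs
    rw [eq_div_iff (by linarith), sub_mul, div_mul_cancel₀ _ (by linarith)]
    ring

section Radical

variable {k : ℝ}

theorem hasDerivAt_s₁ (hk : 0 < k) (t : ℝ) : HasDerivAt (s₁ k) (t / √(k + t ^ 2)) t := by
  have hpos : 0 < k + t ^ 2 := by positivity
  refine (((hasDerivAt_pow 2 t).const_add k).sqrt hpos.ne').congr_deriv ?_
  rw [Nat.cast_ofNat, pow_one, mul_div_mul_left _ _ two_ne_zero]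

theorem hasDerivAt_s₀ (hk : 0 < k) (t : ℝ) :
    HasDerivAt (s₀ k) (k / ((k + t ^ 2) * √(k + t ^ 2))) t := by
  have hpos : 0 < k + t ^ 2 := by positivity
  have hsqrt := Real.sqrt_pos.2 hpos
  refine ((hasDerivAt_id' t).div (hasDerivAt_s₁ hk t) hsqrt.ne').congr_deriv ?_
  simp only [s₁]
  field_simp
  rw [Real.sq_sqrt hpos.le]
  ring

theorem s₁_neg (t : ℝ) : s₁ k (-t) = s₁ k t := by rw [s₁, s₁, neg_sq]

theorem s₀_neg (t : ℝ) : s₀ k (-t) = -s₀ k t := by rw [s₀, s₀, neg_sq, neg_div]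

theorem tendsto_s₁_atTop : Tendsto (s₁ k) atTop atTop :=
  Real.tendsto_sqrt_atTop.comp (tendsto_atTop_add_const_left _ _ (tendsto_pow_atTop two_ne_zero))

theorem tendsto_s₁_atBot : Tendsto (s₁ k) atBot atTop :=
  (tendsto_s₁_atTop.comp tendsto_neg_atBot_atTop).congr s₁_neg

theorem tendsto_s₀_atTop : Tendsto (s₀ k) atTop (𝓝 1) := by
  have hlim : Tendsto (fun t : ℝ => (√(k / t ^ 2 + 1))⁻¹) atTop (𝓝 (√(0 + 1))⁻¹) :=
    (((tendsto_const_nhds.div_atTop (tendsto_pow_atTop two_ne_zero)).add_const 1).sqrt).inv₀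
      (by simp)
  rw [zero_add, Real.sqrt_one, inv_one] at hlim
  refine hlim.congr' ?_
  filter_upwards [eventually_gt_atTop 0] with t ht
  have hroot : √(k / t ^ 2 + 1) = √(k + t ^ 2) / t := by
    rw [div_add_one (by positivity), Real.sqrt_div' _ (by positivity), Real.sqrt_sq ht.le]
  rw [s₀, hroot, inv_div]

theorem tendsto_s₀_atBot : Tendsto (s₀ k) atBot (𝓝 (-1)) :=
  (tendsto_s₀_atTop.comp tendsto_neg_atBot_atTop).neg.congr fun t => by
    rw [Function.comp_apply, s₀_neg, neg_neg]

/-- A primitive of `(a + b t) / ((l + t²) √(k + t²))`, for distinct positive `l` and `k`. -/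
def reducedPrimitive (l k a b t : ℝ) : ℝ :=
  a / (k - l) * G (l / (k - l)) (s₀ k t) + b * G (l - k) (s₁ k t)

variable {l : ℝ}

theorem hasDerivAt_G_comp_s₀ (hl : 0 < l) (hk : 0 < k) (hlk : l ≠ k) (t : ℝ) :
    HasDerivAt (fun t => G (l / (k - l)) (s₀ k t))
      ((k - l) / ((l + t ^ 2) * √(k + t ^ 2))) t := by
  have hk' : 0 < k + t ^ 2 := by positivity
  have : 0 < l + t ^ 2 := by positivity
  have hsub : k - l ≠ 0 := sub_ne_zero.2 hlk.symm
  have hden : l / (k - l) + s₀ k t ^ 2 = k * (l + t ^ 2) / ((k - l) * (k + t ^ 2)) := by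
    rw [s₀, div_pow, Real.sq_sqrt hk'.le]
    field_simp
    ring
  have hG := hasDerivAt_G (ρ := l / (k - l)) (s := s₀ k t) (by rw [hden]; positivity)
  refine (hG.comp t (hasDerivAt_s₀ hk t)).congr_deriv ?_
  rw [hden]
  field_simp

theorem hasDerivAt_G_comp_s₁ (hl : 0 < l) (hk : 0 < k) (t : ℝ) :
    HasDerivAt (fun t => G (l - k) (s₁ k t)) (t / ((l + t ^ 2) * √(k + t ^ 2))) t := by
  have hk' : 0 < k + t ^ 2 := by positivity
  have : 0 < l + t ^ 2 := by positivity
  have hden : l - k + s₁ k t ^ 2 = l + t ^ 2 := by rw [s₁, Real.sq_sqrt hk'.le]; ring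
  have hG := hasDerivAt_G (ρ := l - k) (s := s₁ k t) (by rw [hden]; positivity)
  refine (hG.comp t (hasDerivAt_s₁ hk t)).congr_deriv ?_
  rw [hden]
  field_simp

theorem hasDerivAt_reducedPrimitive (hl : 0 < l) (hk : 0 < k) (hlk : l ≠ k) (a b t : ℝ) :
    HasDerivAt (reducedPrimitive l k a b) ((a + b * t) / ((l + t ^ 2) * √(k + t ^ 2))) t := by
  have hsub : k - l ≠ 0 := sub_ne_zero.2 hlk.symm
  refine (((hasDerivAt_G_comp_s₀ hl hk hlk t).const_mul (a / (k - l))).add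
    ((hasDerivAt_G_comp_s₁ hl hk t).const_mul b)).congr_deriv ?_
  field_simp

theorem tendsto_reducedPrimitive (hk : 0 < k) (hlk : l ≠ k) (a b : ℝ) {F : Filter ℝ} {e : ℝ}
    (he : e ^ 2 = 1) (h₀ : Tendsto (s₀ k) F (𝓝 e)) (h₁ : Tendsto (s₁ k) F atTop) :
    Tendsto (reducedPrimitive l k a b) F
      (𝓝 (a / (k - l) * G (l / (k - l)) e + b * GInfty (l - k))) := by
  have hsub : k - l ≠ 0 := sub_ne_zero.2 hlk.symm
  have hden : l / (k - l) + e ^ 2 ≠ 0 := by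
    rw [he, div_add_one hsub, add_sub_cancel]
    exact div_ne_zero hk.ne' hsub
  exact (((hasDerivAt_G hden).continuousAt.tendsto.comp h₀).const_mul _).add
    (((tendsto_G_atTop _).comp h₁).const_mul _)

end Radical

/-! ### Closed form of the integrals of `h` -/

namespace Params

variable {S : Params}

theorem Qm_eq_kapShift_add_sq (η : ℝ) : S.Qm η = S.kapShift + (η + S.q₁ / 2) ^ 2 := by
  rw [Qm, kapShift]; ring

theorem Dm_eq_lamShift_add_sq (η : ℝ) : S.Dm η = S.lamShift + (η + S.d₁ / 2) ^ 2 := by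
  rw [Dm, lamShift]; ring

theorem kapShift_pos (hQ : ∀ η, 0 < S.Qm η) : 0 < S.kapShift := by
  simpa [Qm_eq_kapShift_add_sq] using hQ (-(S.q₁ / 2))

theorem lamShift_pos (hD : ∀ η, 0 < S.Dm η) : 0 < S.lamShift := by
  simpa [Dm_eq_lamShift_add_sq] using hD (-(S.d₁ / 2))

@[fun_prop]
theorem continuous_Qm : Continuous S.Qm := by unfold Qm; fun_prop

@[fun_prop]
theorem continuous_Dm : Continuous S.Dm := by unfold Dm; fun_prop

section PartialFractions

theorem P_eq_quotient_mul_Dm_add (η : ℝ) :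
    S.P η = (S.p₂ - S.d₁ * S.p₃ + S.p₃ * η) * S.Dm η + (S.n + S.m * η) := by
  rw [P, Dm, n, m]; ring

theorem h_eq_partialFractions (hd : S.d ≠ 0) {η : ℝ} (hD : S.Dm η ≠ 0) :
    S.h η = 1 / (S.d * √(S.Q η)) *
      (S.p₂ - S.d₁ * S.p₃ + S.p₃ * η + (S.n + S.m * η) / S.Dm η) := by
  rw [h, D, P_eq_quotient_mul_Dm_add]
  field_simp

/-- The part of the integrand `d √q h` whose primitive is `Params.E`. -/
def elementaryPart (S : Params) (η : ℝ) : ℝ :=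
  (S.p₂ - S.d₁ * S.p₃ + S.p₃ * η) / √(S.Qm η)

/-- The part of the integrand `d √q h` that keeps the denominator `d₀ + d₁ η + η²`. -/
def remainder (S : Params) (η : ℝ) : ℝ := (S.n + S.m * η) / (S.Dm η * √(S.Qm η))

theorem h_eq_elementaryPart_add_remainder (hq : 0 ≤ S.q) (hd : S.d ≠ 0) {η : ℝ}
    (hD : S.Dm η ≠ 0) :
    S.h η = 1 / (S.d * √S.q) * (S.elementaryPart η + S.remainder η) := by
  rw [h_eq_partialFractions hd hD, Q, Real.sqrt_mul hq, elementaryPart, remainder]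
  field_simp

theorem continuous_elementaryPart (hQ : ∀ η, 0 < S.Qm η) : Continuous S.elementaryPart := by
  unfold elementaryPart
  exact Continuous.div (by fun_prop) (by fun_prop) fun η => (Real.sqrt_pos.2 (hQ η)).ne'

theorem continuous_remainder (hQ : ∀ η, 0 < S.Qm η) (hD : ∀ η, 0 < S.Dm η) :
    Continuous S.remainder := by
  unfold remainder
  exact Continuous.div (by fun_prop) (by fun_prop)
    fun η => (mul_pos (hD η) (Real.sqrt_pos.2 (hQ η))).ne'

theorem continuous_h (hq : 0 ≤ S.q) (hd : S.d ≠ 0) (hQ : ∀ η, 0 < S.Qm η)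
    (hD : ∀ η, 0 < S.Dm η) : Continuous S.h := by
  have hsplit : S.h = fun η => 1 / (S.d * √S.q) * (S.elementaryPart η + S.remainder η) :=
    funext fun η => h_eq_elementaryPart_add_remainder hq hd (hD η).ne'
  rw [hsplit]
  exact ((continuous_elementaryPart hQ).add (continuous_remainder hQ hD)).const_mul _

theorem hasDerivAt_Qm (η : ℝ) : HasDerivAt S.Qm (S.q₁ + 2 * η) η :=
  ((((hasDerivAt_id' η).const_mul S.q₁).const_add S.q₀).add
    (hasDerivAt_pow 2 η)).congr_deriv (by simp)

theorem hasDerivAt_F (hQ : ∀ η, 0 < S.Qm η) (η : ℝ) :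
    HasDerivAt S.F (1 / √(S.Qm η)) η := by
  have hsqrt := Real.sqrt_pos.2 (hQ η)
  have habs : |η + S.q₁ / 2| < √(S.Qm η) := Real.lt_sqrt_of_sq_lt <| by
    rw [sq_abs, Qm_eq_kapShift_add_sq]
    linarith [kapShift_pos hQ]
  have harg : 0 < 2 * √(S.Qm η) + 2 * η + S.q₁ := by linarith [(abs_lt.1 habs).1]
  have hderiv := ((((S.hasDerivAt_Qm η).sqrt (hQ η).ne').const_mul 2).add
    ((hasDerivAt_id' η).const_mul 2)).add_const S.q₁
  refine (hderiv.log harg.ne').congr_deriv ?_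
  simp only [Pi.add_apply]
  rw [div_eq_div_iff harg.ne' hsqrt.ne']
  field_simp
  ring

theorem hasDerivAt_E (hQ : ∀ η, 0 < S.Qm η) (η : ℝ) :
    HasDerivAt S.E (S.elementaryPart η) η := by
  have hsqrt := Real.sqrt_pos.2 (hQ η)
  refine ((((S.hasDerivAt_Qm η).sqrt (hQ η).ne').const_mul S.p₃).add
    ((hasDerivAt_F hQ η).const_mul (S.p₂ - S.d₁ * S.p₃ - S.p₃ * S.q₁ / 2))).congr_deriv ?_
  rw [elementaryPart]
  field_simp
  ring

theorem integral_h_eq (hq : 0 ≤ S.q) (hd : S.d ≠ 0) (hQ : ∀ η, 0 < S.Qm η)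
    (hD : ∀ η, 0 < S.Dm η) {T : ℝ} (hT : ∫ η in (0 : ℝ)..1, S.remainder η = T) :
    ∫ η in (0 : ℝ)..1, S.h η = 1 / (S.d * √S.q) * (S.E 1 - S.E 0 + T) := by
  have hE := (continuous_elementaryPart hQ).intervalIntegrable (μ := volume) 0 1
  simp_rw [fun η => h_eq_elementaryPart_add_remainder hq hd (hD η).ne']
  rw [intervalIntegral.integral_const_mul, intervalIntegral.integral_add hE
    ((continuous_remainder hQ hD).intervalIntegrable _ _), hT,
    intervalIntegral.integral_eq_sub_of_hasDerivAt (fun η _ => hasDerivAt_E hQ η) hE]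

end PartialFractions

end Params

section Substitution

variable {ν μ η : ℝ}

theorem one_add_subst (hη : η ≠ μ) : 1 + subst ν μ η = (ν - μ) / (η - μ) := by
  rw [subst, one_add_div (sub_ne_zero.2 hη)]
  ring

theorem subst_zero : subst ν μ 0 = -ν / μ := by
  rw [subst, sub_zero, zero_sub, div_neg, neg_div]

theorem subst_one : subst ν μ 1 = -(ν - 1) / (μ - 1) := by
  rw [subst, ← neg_sub μ 1, div_neg, neg_div]

theorem hasDerivAt_subst (hη : η ≠ μ) :
    HasDerivAt (subst ν μ) ((μ - ν) / (η - μ) ^ 2) η :=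
  (((hasDerivAt_id' η).const_sub ν).div ((hasDerivAt_id' η).sub_const μ)
    (sub_ne_zero.2 hη)).congr_deriv (by ring)

theorem neg_one_lt_subst (hνμ : ν < μ) (hη : η < μ) : -1 < subst ν μ η := by
  have hpos : 0 < 1 + subst ν μ η := by
    rw [one_add_subst hη.ne]
    exact div_pos_of_neg_of_neg (sub_neg.2 hνμ) (sub_neg.2 hη)
  linarith

theorem subst_lt_neg_one (hνμ : ν < μ) (hη : μ < η) : subst ν μ η < -1 := by
  have hneg : 1 + subst ν μ η < 0 := by
    rw [one_add_subst hη.ne']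
    exact div_neg_of_neg_of_pos (sub_neg.2 hνμ) (sub_pos.2 hη)
  linarith

theorem subst_le_subst (hνμ : ν < μ) {x y : ℝ} (hxy : x ≤ y) (hpole : 0 < (x - μ) * (y - μ)) :
    subst ν μ x ≤ subst ν μ y := by
  have hx : x - μ ≠ 0 := left_ne_zero_of_mul hpole.ne'
  have hy : y - μ ≠ 0 := right_ne_zero_of_mul hpole.ne'
  have hdiff : subst ν μ y - subst ν μ x = (μ - ν) * (y - x) / ((x - μ) * (y - μ)) := by
    rw [subst, subst]; field_simp; ring
  rw [← sub_nonneg, hdiff]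
  exact div_nonneg (mul_nonneg (sub_pos.2 hνμ).le (sub_nonneg.2 hxy)) hpole.le

theorem tendsto_subst_nhdsLT (hνμ : ν < μ) : Tendsto (subst ν μ) (𝓝[<] μ) atTop := by
  have hden : Tendsto (fun η => η - μ) (𝓝[<] μ) (𝓝[<] (μ - μ)) :=
    (by fun_prop : ContinuousWithinAt _ _ _).tendsto_nhdsWithin fun η hη => by simpa using hη
  rw [sub_self] at hden
  have hnum : Tendsto (fun η => ν - η) (𝓝[<] μ) (𝓝 (ν - μ)) :=
    (by fun_prop : ContinuousWithinAt _ _ _)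
  exact hnum.neg_mul_atBot (sub_neg.2 hνμ) (tendsto_inv_nhdsLT_zero.comp hden)

theorem tendsto_subst_nhdsGT (hνμ : ν < μ) : Tendsto (subst ν μ) (𝓝[>] μ) atBot := by
  have hden : Tendsto (fun η => η - μ) (𝓝[>] μ) (𝓝[>] (μ - μ)) :=
    (by fun_prop : ContinuousWithinAt _ _ _).tendsto_nhdsWithin fun η hη => by simpa using hη
  rw [sub_self] at hden
  have hnum : Tendsto (fun η => ν - η) (𝓝[>] μ) (𝓝 (ν - μ)) :=
    (by fun_prop : ContinuousWithinAt _ _ _)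
  exact hnum.neg_mul_atTop (sub_neg.2 hνμ) (tendsto_inv_nhdsGT_zero.comp hden)

theorem quadratic_mul_one_add_subst_sq {a b : ℝ}
    (hpolar : 2 * (ν * μ) + b * (ν + μ) + 2 * a = 0) (hμ : a + b * μ + μ ^ 2 ≠ 0) (hη : η ≠ μ) :
    (a + b * η + η ^ 2) * (1 + subst ν μ η) ^ 2 = (a + b * μ + μ ^ 2) *
      ((a + b * ν + ν ^ 2) / (a + b * μ + μ ^ 2) + subst ν μ η ^ 2) := by
  have hημ : η - μ ≠ 0 := sub_ne_zero.2 hη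
  rw [one_add_subst hη, subst, mul_add, mul_div_cancel₀ _ hμ]
  field_simp
  linear_combination (η - μ) * (ν - η) * hpolar

theorem exists_lt_quadratic_eq_zero_iff {a b c : ℝ} (ha : a ≠ 0) (h : 0 < discrim a b c) :
    ∃ ν μ : ℝ, ν < μ ∧ ∀ z, a * (z * z) + b * z + c = 0 ↔ z = ν ∨ z = μ := by
  have hroots := quadratic_eq_zero_iff ha (Real.mul_self_sqrt h.le).symm
  have hne : (-b + √(discrim a b c)) / (2 * a) ≠ (-b - √(discrim a b c)) / (2 * a) := by
    intro heq
    rw [div_left_inj' (by positivity)] at heq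
    linarith [Real.sqrt_pos.2 h]
  rcases hne.lt_or_gt with hlt | hlt
  · exact ⟨_, _, hlt, hroots⟩
  · exact ⟨_, _, hlt, fun z => (hroots z).trans or_comm⟩

end Substitution

namespace Params

variable {S : Params} {ν μ : ℝ}

/-- A pair of points `ν < μ` conjugate with respect to both monic quadratics, in the sense that
the polar forms of `Qm` and `Dm` vanish at `(ν, μ)`. Written in the variable `subst ν μ η`, both
quadratics then lose their linear term. -/
structure IsConjugatePair (S : Params) (ν μ : ℝ) : Prop where
  lt : ν < μ
  polar_Qm : 2 * (ν * μ) + S.q₁ * (ν + μ) + 2 * S.q₀ = 0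
  polar_Dm : 2 * (ν * μ) + S.d₁ * (ν + μ) + 2 * S.d₀ = 0

theorem isConjugatePair_of_roots (h₁ : S.d₁ ≠ S.q₁) (hlt : ν < μ)
    (hroot : ∀ z ∈ ({ν, μ} : Set ℝ), (S.d₁ - S.q₁) * z ^ 2 + 2 * (S.d₀ - S.q₀) * z
      + (S.q₁ * S.d₀ - S.d₁ * S.q₀) = 0) : S.IsConjugatePair ν μ := by
  have ha : S.d₁ - S.q₁ ≠ 0 := sub_ne_zero.2 h₁
  have hν := hroot ν (by simp)
  have hμ := hroot μ (by simp)
  have hsum : (S.d₁ - S.q₁) * (ν + μ) = -2 * (S.d₀ - S.q₀) :=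
    mul_left_cancel₀ (sub_ne_zero.2 hlt.ne) (by linear_combination hν - hμ)
  have hprod : (S.d₁ - S.q₁) * (ν * μ) = S.q₁ * S.d₀ - S.d₁ * S.q₀ := by
    linear_combination ν * hsum - hν
  exact ⟨hlt, mul_left_cancel₀ ha (by linear_combination 2 * hprod + S.q₁ * hsum),
    mul_left_cancel₀ ha (by linear_combination 2 * hprod + S.d₁ * hsum)⟩

theorem exists_isConjugatePair (hQ : ∀ η, 0 < S.Qm η) (h₁ : S.d₁ ≠ S.q₁) :
    ∃ ν μ : ℝ, S.IsConjugatePair ν μ ∧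
      ∀ z : ℝ, (S.d₁ - S.q₁) * z ^ 2 + 2 * (S.d₀ - S.q₀) * z
        + (S.q₁ * S.d₀ - S.d₁ * S.q₀) = 0 ↔ z = ν ∨ z = μ := by
  have ha : S.d₁ - S.q₁ ≠ 0 := sub_ne_zero.2 h₁
  have hk := kapShift_pos hQ
  have hdisc : 0 < discrim (S.d₁ - S.q₁) (2 * (S.d₀ - S.q₀)) (S.q₁ * S.d₀ - S.d₁ * S.q₀) := by
    have hsos : discrim (S.d₁ - S.q₁) (2 * (S.d₀ - S.q₀)) (S.q₁ * S.d₀ - S.d₁ * S.q₀)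
        = (2 * (S.d₀ - S.q₀) - (S.d₁ - S.q₁) * S.q₁) ^ 2
          + 4 * ((S.d₁ - S.q₁) ^ 2 * S.kapShift) := by
      rw [discrim, kapShift]; ring
    rw [hsos]
    positivity
  obtain ⟨ν, μ, hlt, hroots⟩ := exists_lt_quadratic_eq_zero_iff ha hdisc
  simp only [← sq] at hroots
  exact ⟨ν, μ, isConjugatePair_of_roots h₁ hlt fun z hz => (hroots z).2 hz, hroots⟩

namespace IsConjugatePair

theorem Qm_mul_one_add_subst_sq (hc : S.IsConjugatePair ν μ) (hQ : S.Qm μ ≠ 0) {η : ℝ}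
    (hη : η ≠ μ) :
    S.Qm η * (1 + subst ν μ η) ^ 2 = S.Qm μ * (S.kap ν μ + subst ν μ η ^ 2) :=
  quadratic_mul_one_add_subst_sq hc.polar_Qm hQ hη

theorem Dm_mul_one_add_subst_sq (hc : S.IsConjugatePair ν μ) (hD : S.Dm μ ≠ 0) {η : ℝ}
    (hη : η ≠ μ) :
    S.Dm η * (1 + subst ν μ η) ^ 2 = S.Dm μ * (S.lam ν μ + subst ν μ η ^ 2) :=
  quadratic_mul_one_add_subst_sq hc.polar_Dm hD hη

theorem lam_ne_kap (hc : S.IsConjugatePair ν μ) (hQ : S.Qm μ ≠ 0) (hD : S.Dm μ ≠ 0)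
    (h₁ : S.d₁ ≠ S.q₁) : S.lam ν μ ≠ S.kap ν μ := by
  intro heq
  rw [lam, kap, div_eq_div_iff hD hQ] at heq
  have hνμ : ν - μ ≠ 0 := sub_ne_zero.2 hc.lt.ne
  have hQsum : S.Qm ν + S.Qm μ = (ν - μ) ^ 2 := by
    rw [Qm, Qm]; linear_combination hc.polar_Qm
  have hDsum : S.Dm ν + S.Dm μ = (ν - μ) ^ 2 := by
    rw [Dm, Dm]; linear_combination hc.polar_Dm
  have hμ : S.Dm μ = S.Qm μ := mul_left_cancel₀ (pow_ne_zero 2 hνμ) <| by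
    linear_combination S.Qm μ * hDsum - S.Dm μ * hQsum - heq
  have hν : S.Dm ν = S.Qm ν := by linarith
  simp only [Dm, Qm] at hμ hν
  exact h₁ (mul_left_cancel₀ hνμ (by linear_combination hν - hμ))

end IsConjugatePair

theorem H_eq_reducedPrimitive (t : ℝ) :
    S.H ν μ t = S.omega ν μ * SignType.sign (1 + t) *
      reducedPrimitive (S.lam ν μ) (S.kap ν μ) (S.n + S.m * ν) (S.n + S.m * μ) t := rfl

namespace IsConjugatePair

variable (hc : S.IsConjugatePair ν μ) (hQ : ∀ η, 0 < S.Qm η) (hD : ∀ η, 0 < S.Dm η)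

include hc hQ hD in
theorem remainder_eq {η : ℝ} (hη : η ≠ μ) :
    S.remainder η = S.omega ν μ * SignType.sign (1 + subst ν μ η) *
      ((S.n + S.m * ν + (S.n + S.m * μ) * subst ν μ η) /
        ((S.lam ν μ + subst ν μ η ^ 2) * √(S.kap ν μ + subst ν μ η ^ 2)) *
      ((μ - ν) / (η - μ) ^ 2)) := by
  have hημ : η - μ ≠ 0 := sub_ne_zero.2 hη
  have hμν : 0 < μ - ν := sub_pos.2 hc.lt
  have hlinear : S.n + S.m * ν + (S.n + S.m * μ) * subst ν μ η
      = (S.n + S.m * η) * (1 + subst ν μ η) := by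
    rw [subst]; field_simp; ring
  have hjac : (μ - ν) / (η - μ) ^ 2 = (1 + subst ν μ η) ^ 2 / (μ - ν) := by
    rw [one_add_subst hη]; field_simp; ring
  have hsub : 1 + subst ν μ η ≠ 0 := by
    rw [one_add_subst hη]; exact div_ne_zero (sub_ne_zero.2 hc.lt.ne) hημ
  have hQη := hc.Qm_mul_one_add_subst_sq (hQ μ).ne' hη
  have hDη := hc.Dm_mul_one_add_subst_sq (hD μ).ne' hη
  rw [hlinear, hjac, omega, remainder]
  generalize subst ν μ η = t at *
  have hsqrt : √(S.Qm η) * |1 + t| = √(S.Qm μ) * √(S.kap ν μ + t ^ 2) := by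
    rw [← Real.sqrt_sq_eq_abs, ← Real.sqrt_mul (hQ η).le, hQη, Real.sqrt_mul (hQ μ).le]
  have hden : S.Dm μ * √(S.Qm μ) * ((S.lam ν μ + t ^ 2) * √(S.kap ν μ + t ^ 2))
      = S.Dm η * √(S.Qm η) * ((1 + t) ^ 2 * |1 + t|) := by
    linear_combination -√(S.Qm μ) * √(S.kap ν μ + t ^ 2) * hDη - S.Dm η * (1 + t) ^ 2 * hsqrt
  have hQpos := Real.sqrt_pos.2 (hQ η)
  have hDpos := hD η
  have := abs_pos.2 hsub
  calc _ = (S.n + S.m * η) * ((SignType.sign (1 + t) * (1 + t)) * (1 + t) ^ 2) /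
        (S.Dm η * √(S.Qm η) * ((1 + t) ^ 2 * |1 + t|)) := by
        rw [sign_mul_self]; field_simp
    _ = _ := by
        rw [← hden]; field_simp

include hc hQ hD in
theorem hasDerivAt_H_subst (h₁ : S.d₁ ≠ S.q₁) {η : ℝ} (hη : η ≠ μ) :
    HasDerivAt (fun x => S.H ν μ (subst ν μ x)) (S.remainder η) η := by
  have hsubst := hasDerivAt_subst (ν := ν) hη
  have hne : 1 + subst ν μ η ≠ 0 := by
    rw [one_add_subst hη]
    exact div_ne_zero (sub_ne_zero.2 hc.lt.ne) (sub_ne_zero.2 hη)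
  have hprim := (hasDerivAt_reducedPrimitive (div_pos (hD ν) (hD μ)) (div_pos (hQ ν) (hQ μ))
    (hc.lam_ne_kap (hQ μ).ne' (hD μ).ne' h₁) (S.n + S.m * ν) (S.n + S.m * μ) _).comp η hsubst
  have hsign : ∀ᶠ x in 𝓝 η, SignType.sign (1 + subst ν μ x) = SignType.sign (1 + subst ν μ η) :=
    ((continuousAt_sign_of_ne_zero hne).comp_of_eq (hsubst.continuousAt.const_add 1)
      rfl).preimage_mem_nhds ((isOpen_discrete {_}).mem_nhds rfl)
  rw [hc.remainder_eq hQ hD hη]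
  refine (hprim.const_mul _).congr_of_eventuallyEq ?_
  filter_upwards [hsign] with x hx
  rw [H_eq_reducedPrimitive, hx, Function.comp_apply]
  rfl

include hc hQ hD in
theorem tendsto_H_atTop (h₁ : S.d₁ ≠ S.q₁) :
    Tendsto (S.H ν μ) atTop (𝓝 (S.HTop ν μ)) := by
  refine ((tendsto_reducedPrimitive (div_pos (hQ ν) (hQ μ))
    (hc.lam_ne_kap (hQ μ).ne' (hD μ).ne' h₁) (S.n + S.m * ν) (S.n + S.m * μ)
    (one_pow 2) tendsto_s₀_atTop tendsto_s₁_atTop).const_mul (S.omega ν μ)).congr' ?_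
  filter_upwards [eventually_gt_atTop (-1)] with t ht
  rw [H_eq_reducedPrimitive, sign_pos (by linarith : 0 < 1 + t), SignType.coe_one, mul_one, kap]

include hc hQ hD in
theorem tendsto_H_atBot (h₁ : S.d₁ ≠ S.q₁) :
    Tendsto (S.H ν μ) atBot (𝓝 (S.HBot ν μ)) := by
  refine ((tendsto_reducedPrimitive (div_pos (hQ ν) (hQ μ))
    (hc.lam_ne_kap (hQ μ).ne' (hD μ).ne' h₁) (S.n + S.m * ν) (S.n + S.m * μ)
    neg_one_sq tendsto_s₀_atBot tendsto_s₁_atBot).const_mul (-S.omega ν μ)).congr' ?_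
  filter_upwards [eventually_lt_atBot (-1)] with t ht
  rw [H_eq_reducedPrimitive, sign_neg (by linarith : 1 + t < 0), SignType.coe_neg_one,
    mul_neg_one, kap]

include hc hQ hD in
theorem integral_remainder_of_notMem (h₁ : S.d₁ ≠ S.q₁) {a b : ℝ} (hμ : μ ∉ uIcc a b) :
    ∫ η in a..b, S.remainder η = S.H ν μ (subst ν μ b) - S.H ν μ (subst ν μ a) :=
  intervalIntegral.integral_eq_sub_of_hasDerivAt
    (fun _ hx => hc.hasDerivAt_H_subst hQ hD h₁ (ne_of_mem_of_not_mem hx hμ))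
    ((continuous_remainder hQ hD).intervalIntegrable _ _)

include hc hQ hD in
theorem integral_remainder_left (h₁ : S.d₁ ≠ S.q₁) {a : ℝ} (ha : a < μ) :
    ∫ η in a..μ, S.remainder η = S.HTop ν μ - S.H ν μ (subst ν μ a) :=
  intervalIntegral.integral_eq_sub_of_hasDerivAt_of_tendsto ha
    (fun _ hx => hc.hasDerivAt_H_subst hQ hD h₁ hx.2.ne)
    ((continuous_remainder hQ hD).intervalIntegrable _ _)
    ((hc.hasDerivAt_H_subst hQ hD h₁ ha.ne).continuousAt.tendsto.mono_left nhdsWithin_le_nhds)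
    ((hc.tendsto_H_atTop hQ hD h₁).comp (tendsto_subst_nhdsLT hc.lt))

include hc hQ hD in
theorem integral_remainder_right (h₁ : S.d₁ ≠ S.q₁) {b : ℝ} (hb : μ < b) :
    ∫ η in μ..b, S.remainder η = S.H ν μ (subst ν μ b) - S.HBot ν μ :=
  intervalIntegral.integral_eq_sub_of_hasDerivAt_of_tendsto hb
    (fun _ hx => hc.hasDerivAt_H_subst hQ hD h₁ hx.1.ne')
    ((continuous_remainder hQ hD).intervalIntegrable _ _)
    ((hc.tendsto_H_atBot hQ hD h₁).comp (tendsto_subst_nhdsGT hc.lt))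
    ((hc.hasDerivAt_H_subst hQ hD h₁ hb.ne').continuousAt.tendsto.mono_left nhdsWithin_le_nhds)

include hc hQ hD in
theorem integral_remainder_of_mem_Ioo (h₁ : S.d₁ ≠ S.q₁) {a b : ℝ} (hμ : μ ∈ Ioo a b) :
    ∫ η in a..b, S.remainder η = S.H ν μ (subst ν μ b) - S.HBot ν μ + S.HTop ν μ
      - S.H ν μ (subst ν μ a) := by
  have hint (x y : ℝ) := (continuous_remainder hQ hD).intervalIntegrable (μ := volume) x y
  rw [← intervalIntegral.integral_add_adjacent_intervals (hint a μ) (hint μ b),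
    hc.integral_remainder_left hQ hD h₁ hμ.1, hc.integral_remainder_right hQ hD h₁ hμ.2]
  ring

include hc hQ hD in
theorem integral_remainder_alternatives (h₁ : S.d₁ ≠ S.q₁) (hμ₀ : μ ≠ 0) (hμ₁ : μ ≠ 1)
    {t₀ t₁ : ℝ} (ht₀ : t₀ = min (-ν / μ) (-(ν - 1) / (μ - 1)))
    (ht₁ : t₁ = max (-ν / μ) (-(ν - 1) / (μ - 1))) :
    ((-1 < t₀ ∨ t₁ < -1) ∧
      ∫ η in (0 : ℝ)..1, S.remainder η = S.H ν μ t₁ - S.H ν μ t₀) ∨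
    ((t₀ < -1 ∧ -1 < t₁) ∧
      ∫ η in (0 : ℝ)..1, S.remainder η =
        S.H ν μ t₀ - S.HBot ν μ + S.HTop ν μ - S.H ν μ t₁) := by
  rw [← subst_zero, ← subst_one] at ht₀ ht₁
  by_cases hμ : μ ∈ Icc (0 : ℝ) 1
  · have hμ' : μ ∈ Ioo (0 : ℝ) 1 := ⟨hμ.1.lt_of_ne' hμ₀, hμ.2.lt_of_ne hμ₁⟩
    have hzero := neg_one_lt_subst hc.lt hμ'.1
    have hone := subst_lt_neg_one hc.lt hμ'.2
    rw [min_eq_right (hone.trans hzero).le] at ht₀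
    rw [max_eq_left (hone.trans hzero).le] at ht₁
    subst ht₀ ht₁
    exact Or.inr ⟨⟨hone, hzero⟩, hc.integral_remainder_of_mem_Ioo hQ hD h₁ hμ'⟩
  · have hside : μ < 0 ∨ 1 < μ := by simpa only [mem_Icc, not_and_or, not_le] using hμ
    have hle : subst ν μ 0 ≤ subst ν μ 1 :=
      subst_le_subst hc.lt zero_le_one (by rcases hside with h | h <;> nlinarith)
    rw [min_eq_left hle] at ht₀
    rw [max_eq_right hle] at ht₁
    subst ht₀ ht₁
    refine Or.inl ⟨hside.symm.imp (fun h => neg_one_lt_subst hc.lt (by linarith))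
      fun h => subst_lt_neg_one hc.lt (by linarith), ?_⟩
    exact hc.integral_remainder_of_notMem hQ hD h₁ (by rwa [uIcc_of_le zero_le_one])

theorem integral_remainder_of_eq_zero (hc : S.IsConjugatePair ν 0) (hQ : ∀ η, 0 < S.Qm η)
    (hD : ∀ η, 0 < S.Dm η) (h₁ : S.d₁ ≠ S.q₁) :
    ∫ η in (0 : ℝ)..1, S.remainder η = S.H ν 0 (ν - 1) - S.HBot ν 0 := by
  rw [hc.integral_remainder_right hQ hD h₁ one_pos, subst, sub_zero, div_one]

theorem integral_remainder_of_eq_one (hc : S.IsConjugatePair ν 1) (hQ : ∀ η, 0 < S.Qm η)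
    (hD : ∀ η, 0 < S.Dm η) (h₁ : S.d₁ ≠ S.q₁) :
    ∫ η in (0 : ℝ)..1, S.remainder η = S.HTop ν 1 - S.H ν 1 (-ν) := by
  rw [hc.integral_remainder_left hQ hD h₁ one_pos, subst_zero, div_one]

end IsConjugatePair

section Shift

variable (hQ : ∀ η, 0 < S.Qm η) (hD : ∀ η, 0 < S.Dm η)

include hQ hD in
theorem integral_remainder_of_hasDerivAt_shift (h₁ : S.d₁ = S.q₁) {K : ℝ → ℝ}
    (hK : ∀ t, HasDerivAt K ((S.n - S.m * S.q₁ / 2 + S.m * t) /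
      ((S.lamShift + t ^ 2) * √(S.kapShift + t ^ 2))) t) :
    ∫ η in (0 : ℝ)..1, S.remainder η = K (1 + S.q₁ / 2) - K (S.q₁ / 2) := by
  have hderiv (η : ℝ) : HasDerivAt (fun x => K (x + S.q₁ / 2)) (S.remainder η) η := by
    refine ((hK _).comp_add_const η (S.q₁ / 2)).congr_deriv ?_
    rw [remainder, Qm_eq_kapShift_add_sq, Dm_eq_lamShift_add_sq, h₁]
    ring
  rw [intervalIntegral.integral_eq_sub_of_hasDerivAt (fun η _ => hderiv η)
    ((continuous_remainder hQ hD).intervalIntegrable _ _), zero_add]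

include hQ hD in
theorem integral_remainder_eq_HShift (h₁ : S.d₁ = S.q₁) (h₀ : S.d₀ ≠ S.q₀) :
    ∫ η in (0 : ℝ)..1, S.remainder η = S.HShift (1 + S.q₁ / 2) - S.HShift (S.q₁ / 2) := by
  have hlk : S.lamShift ≠ S.kapShift := by
    rwa [lamShift, kapShift, h₁, Ne, sub_left_inj]
  exact integral_remainder_of_hasDerivAt_shift hQ hD h₁
    (hasDerivAt_reducedPrimitive (lamShift_pos hD) (kapShift_pos hQ) hlk _ _)

include hQ hD in
theorem integral_remainder_eq_HProp (h₁ : S.d₁ = S.q₁) (h₀ : S.d₀ = S.q₀) :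
    ∫ η in (0 : ℝ)..1, S.remainder η = S.HProp (1 + S.q₁ / 2) - S.HProp (S.q₁ / 2) := by
  have hk := kapShift_pos hQ
  have hlk : S.lamShift = S.kapShift := by rw [lamShift, kapShift, h₀, h₁]
  refine integral_remainder_of_hasDerivAt_shift hQ hD h₁ fun t => ?_
  have hG := hasDerivAt_G_comp_s₁ hk hk t
  rw [sub_self] at hG
  refine (((hasDerivAt_s₀ hk t).const_mul ((S.n - S.m * S.q₁ / 2) / S.kapShift)).add
    (hG.const_mul S.m)).congr_deriv ?_
  rw [hlk]
  field_simp

end Shift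

end Params

/-! ### Line integrals of `(a + b x) / ‖x • A + B‖³` -/

theorem eq_zero_of_smul_add_smul_add_smul_eq_zero {R M : Type*} [Ring R] [AddCommGroup M]
    [Module R M] {x y z : M} (h : LinearIndependent R ![x, y, z]) {a b c : R}
    (habc : a • x + b • y + c • z = 0) : a = 0 ∧ b = 0 ∧ c = 0 := by
  have hcoeff := Fintype.linearIndependent_iff.1 h ![a, b, c]
    (by simpa only [Fin.sum_univ_three, Matrix.cons_val] using habc)
  exact ⟨hcoeff 0, hcoeff 1, hcoeff 2⟩

section LineIntegral

variable {V : Type*} [NormedAddCommGroup V] [InnerProductSpace ℝ V] {A B : V}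

theorem det_gram_pair (A B : V) :
    (Matrix.gram ℝ ![A, B]).det = ‖A‖ ^ 2 * ‖B‖ ^ 2 - ⟪A, B⟫ ^ 2 := by
  simp only [Matrix.det_fin_two, Matrix.gram_apply, Matrix.cons_val_zero, Matrix.cons_val_one,
    real_inner_self_eq_norm_sq, real_inner_comm A B, sq ⟪A, B⟫]

theorem norm_sq_mul_norm_sq_sub_inner_sq_pos (h : LinearIndependent ℝ ![A, B]) :
    0 < ‖A‖ ^ 2 * ‖B‖ ^ 2 - ⟪A, B⟫ ^ 2 :=
  det_gram_pair A B ▸ (Matrix.posDef_gram_of_linearIndependent h).det_pos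

theorem smul_add_ne_zero (h : LinearIndependent ℝ ![A, B]) (x : ℝ) : x • A + B ≠ 0 :=
  fun h₀ => one_ne_zero (LinearIndependent.pair_iff.1 h x 1 (by rwa [one_smul])).2

/-- The numerator of `linePrimitive`. -/
def lineNum (A B : V) (a b x : ℝ) : ℝ :=
  (a * ‖A‖ ^ 2 - b * ⟪A, B⟫) * x + a * ⟪A, B⟫ - b * ‖B‖ ^ 2

/-- A primitive of `(a + b x) / ‖x • A + B‖³`, for linearly independent `A` and `B`. -/
def linePrimitive (A B : V) (a b x : ℝ) : ℝ :=
  lineNum A B a b x / ((‖A‖ ^ 2 * ‖B‖ ^ 2 - ⟪A, B⟫ ^ 2) * ‖x • A + B‖)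

theorem hasDerivAt_norm_smul_add {x : ℝ} (hx : x • A + B ≠ 0) :
    HasDerivAt (fun x : ℝ => ‖x • A + B‖) (⟪x • A + B, A⟫ / ‖x • A + B‖) x := by
  have hline : HasDerivAt (fun x : ℝ => x • A + B) A x :=
    (((hasDerivAt_id' x).smul_const A).add_const B).congr_deriv (one_smul ℝ A)
  have hsqrt := hline.norm_sq.sqrt (by positivity)
  simp only [Real.sqrt_sq (norm_nonneg _)] at hsqrt
  exact hsqrt.congr_deriv (mul_div_mul_left _ _ two_ne_zero)

theorem hasDerivAt_linePrimitive (h : LinearIndependent ℝ ![A, B]) (a b x : ℝ) :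
    HasDerivAt (linePrimitive A B a b) ((a + b * x) / ‖x • A + B‖ ^ 3) x := by
  have hdet := norm_sq_mul_norm_sq_sub_inner_sq_pos h
  have hx := smul_add_ne_zero h x
  have hnorm : 0 < ‖x • A + B‖ := norm_pos_iff.2 hx
  have hnum : HasDerivAt (lineNum A B a b) (a * ‖A‖ ^ 2 - b * ⟪A, B⟫) x :=
    ((((hasDerivAt_id' x).const_mul (a * ‖A‖ ^ 2 - b * ⟪A, B⟫)).add_const
      (a * ⟪A, B⟫)).sub_const (b * ‖B‖ ^ 2)).congr_deriv (mul_one _)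
  have hsq : ‖x • A + B‖ ^ 2 = ‖A‖ ^ 2 * x ^ 2 + 2 * ⟪A, B⟫ * x + ‖B‖ ^ 2 := by
    rw [norm_add_sq_real, norm_smul, real_inner_smul_left, mul_pow, Real.norm_eq_abs, sq_abs]
    ring
  have hinner : ⟪x • A + B, A⟫ = ‖A‖ ^ 2 * x + ⟪A, B⟫ := by
    rw [inner_add_left, real_inner_smul_left, real_inner_self_eq_norm_sq, real_inner_comm A B,
      mul_comm]
  refine (hnum.div ((hasDerivAt_norm_smul_add hx).const_mul _) (by positivity)).congr_deriv ?_
  rw [hinner, lineNum]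
  generalize ‖x • A + B‖ = N at *
  field_simp
  rw [hsq]
  ring

theorem integral_line (h : LinearIndependent ℝ ![A, B]) (a b k : ℝ) :
    ∫ t in (0 : ℝ)..1, k * (a + b * (k * t)) / ‖(k * t) • A + B‖ ^ 3 =
      linePrimitive A B a b k - linePrimitive A B a b 0 := by
  have hderiv (t : ℝ) : HasDerivAt (fun t => linePrimitive A B a b (k * t))
      (k * (a + b * (k * t)) / ‖(k * t) • A + B‖ ^ 3) t :=
    ((hasDerivAt_linePrimitive h a b (k * t)).comp t
      ((hasDerivAt_id' t).const_mul k)).congr_deriv (by ring)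
  have hcont : Continuous fun t : ℝ => k * (a + b * (k * t)) / ‖(k * t) • A + B‖ ^ 3 :=
    Continuous.div (by fun_prop) (by fun_prop) fun t =>
      pow_ne_zero 3 (norm_ne_zero_iff.2 (smul_add_ne_zero h (k * t)))
  rw [intervalIntegral.integral_eq_sub_of_hasDerivAt (fun t _ => hderiv t)
    (hcont.intervalIntegrable _ _), mul_one, mul_zero]

end LineIntegral

/-! ### The slices of the regularised integrands -/

/-- The integrand number `i + 1` is `k (a + b k η₄) / ‖k η₄ A + B‖³` with `A = edgeDir`. -/
def edgeDir (u v w : E3) : Fin 5 → E3 := ![w, u + v, v + w, u, v + w]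

/-- The vector `B` of the integrand `k (a + b k η₄) / ‖k η₄ A + B‖³`. -/
def edgeBase (u v w : E3) (η : ℝ) : Fin 5 → E3 :=
  ![η • (u + v) - u, w - η • u, u - η • w, η • (v + w) - w, η • u - w]

/-- The factor `k` of the integrand `k (a + b k η₄) / ‖k η₄ A + B‖³`. -/
def edgeStep (η : ℝ) : Fin 5 → ℝ := ![1, η, η, η, η]

/-- The constant `a` of the integrand `k (a + b k η₄) / ‖k η₄ A + B‖³`. -/
def edgeConst (c₀ c₂ η : ℝ) : Fin 5 → ℝ :=
  ![0, c₀ + c₂ * η, η * (c₀ + c₂), (1 - η) * c₀, c₀ + c₂ * η]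

/-- The slope `b` of the integrand `k (a + b k η₄) / ‖k η₄ A + B‖³`. -/
def edgeSlope (c₀ c₁ c₂ η : ℝ) : Fin 5 → ℝ :=
  ![c₀ + c₁ * η + c₂ * (1 - η), c₁ - c₂, -(c₀ + c₂), (1 - η) * c₂, -(c₀ + c₂ * η)]

theorem edgeIntegrand_eq (u v w : E3) (c₀ c₁ c₂ : ℝ) (i : Fin 5) (η t : ℝ) :
    edgeIntegrand u v w c₀ c₁ c₂ i (η, t) =
      edgeStep η i * (edgeConst c₀ c₂ η i + edgeSlope c₀ c₁ c₂ η i * (edgeStep η i * t))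
        / ‖(edgeStep η i * t) • edgeDir u v w i + edgeBase u v w η i‖ ^ 3 := by
  have e₁ : η • (u + v) + t • w - u = (1 * t) • w + (η • (u + v) - u) := by module
  have e₂ : (η * t) • (u + v) - η • u + w = (η * t) • (u + v) + (w - η • u) := by module
  have e₃ : (η * t) • (w + v) - η • w + u = (η * t) • (v + w) + (u - η • w) := by module
  have e₄ : (η * t) • u + η • (w + v) - w = (η * t) • u + (η • (v + w) - w) := by module
  have e₅ : (η * t) • (w + v) + η • u - w = (η * t) • (v + w) + (η • u - w) := by module
  fin_cases i <;>
    simp only [edgeIntegrand, edgeStep, edgeConst, edgeSlope, edgeDir, edgeBase, e₁, e₂, e₃, e₄,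
      e₅, Fin.zero_eta, Fin.mk_one, Fin.reduceFinMk, Matrix.cons_val] <;>
    ring

section Tables

theorem tabD_quadratic_eq (u v w : E3) (i : Fin 5) (η : ℝ) :
    tabD₀ u v w i + 2 * tabD₁ u v w i * η + tabD u v w i * η ^ 2 =
      ‖edgeDir u v w i‖ ^ 2 * ‖edgeBase u v w η i‖ ^ 2
        - ⟪edgeDir u v w i, edgeBase u v w η i⟫ ^ 2 := by
  fin_cases i <;>
    simp only [tabD₀, tabD₁, tabD, edgeDir, edgeBase, Fin.zero_eta, Fin.mk_one, Fin.reduceFinMk,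
      Matrix.cons_val, ← real_inner_self_eq_norm_sq, inner_add_left, inner_add_right,
      inner_sub_left, inner_sub_right, real_inner_smul_left, real_inner_smul_right,
      real_inner_comm u v, real_inner_comm u w, real_inner_comm v w] <;>
    ring

theorem tabQ_quadratic_eq (u v w : E3) (i : Fin 5) (j : Fin 2) (η : ℝ) :
    tabQ₀ u w i j + 2 * tabQ₁ u v w i j * η + tabQ u v w i j * η ^ 2 =
      ‖(![0, edgeStep η i] j : ℝ) • edgeDir u v w i + edgeBase u v w η i‖ ^ 2 := by
  fin_cases i <;> fin_cases j <;>
    simp only [tabQ₀, tabQ₁, tabQ, edgeDir, edgeBase, edgeStep, Fin.zero_eta, Fin.mk_one,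
      Fin.reduceFinMk, Matrix.cons_val, ← real_inner_self_eq_norm_sq, inner_add_left,
      inner_add_right, inner_sub_left, inner_sub_right, real_inner_smul_left,
      real_inner_smul_right, real_inner_comm u v, real_inner_comm u w, real_inner_comm v w] <;>
    ring

theorem edgeParams_P (u v w : E3) (c₀ c₁ c₂ : ℝ) (i : Fin 5) (j : Fin 2) (η : ℝ) :
    (edgeParams u v w c₀ c₁ c₂ i j).P η =
      lineNum (edgeDir u v w i) (edgeBase u v w η i) (edgeConst c₀ c₂ η i)
        (edgeSlope c₀ c₁ c₂ η i) (![0, edgeStep η i] j) := by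
  fin_cases i <;> fin_cases j <;>
    simp only [Params.P, edgeParams, tabP₀, tabP₁, tabP₂, tabP₃, lineNum, edgeDir, edgeBase,
      edgeStep, edgeConst, edgeSlope, Fin.zero_eta, Fin.mk_one, Fin.reduceFinMk, Matrix.cons_val,
      ← real_inner_self_eq_norm_sq, inner_add_left, inner_add_right, inner_sub_left,
      inner_sub_right, real_inner_smul_left, real_inner_smul_right,
      real_inner_comm u v, real_inner_comm u w, real_inner_comm v w] <;>
    ring

end Tables

section Slices

variable {u v w : E3}

theorem linearIndependent_edgeDir_edgeBase (h : LinearIndependent ℝ ![u, v, w]) (i : Fin 5)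
    (η : ℝ) : LinearIndependent ℝ ![edgeDir u v w i, edgeBase u v w η i] := by
  refine LinearIndependent.pair_iff.2 fun a b hab => ?_
  have hcoeff {x y z : ℝ} (hxyz : x • u + y • v + z • w =
      a • edgeDir u v w i + b • edgeBase u v w η i) : x = 0 ∧ y = 0 ∧ z = 0 :=
    eq_zero_of_smul_add_smul_add_smul_eq_zero h (hxyz.trans hab)
  fin_cases i <;>
    simp only [edgeDir, edgeBase, Fin.zero_eta, Fin.mk_one, Fin.reduceFinMk, Matrix.cons_val]
      at hcoeff
  · obtain ⟨hu, hv, hw⟩ := @hcoeff (b * η - b) (b * η) a (by module)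
    exact ⟨hw, by linarith⟩
  · obtain ⟨-, hv, hw⟩ := @hcoeff (a - b * η) a b (by module)
    exact ⟨hv, hw⟩
  · obtain ⟨hu, hv, -⟩ := @hcoeff b a (a - b * η) (by module)
    exact ⟨hv, hu⟩
  · obtain ⟨hu, hv, hw⟩ := @hcoeff a (b * η) (b * η - b) (by module)
    exact ⟨hu, by linarith⟩
  · obtain ⟨-, hv, hw⟩ := @hcoeff (b * η) a (a - b) (by module)
    exact ⟨hv, by linarith⟩

theorem tabQ_pos (h : LinearIndependent ℝ ![u, v, w]) (i : Fin 5) (j : Fin 2) :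
    0 < tabQ u v w i j := by
  have hpos {x y z : ℝ} (hxyz : ¬(x = 0 ∧ y = 0 ∧ z = 0)) : 0 < ‖x • u + y • v + z • w‖ ^ 2 := by
    have hne := mt (eq_zero_of_smul_add_smul_add_smul_eq_zero h) hxyz
    positivity
  have hu := @hpos 1 0 0 (by norm_num)
  have hv := @hpos 0 1 0 (by norm_num)
  have hw := @hpos 0 0 1 (by norm_num)
  have huv := @hpos 1 1 0 (by norm_num)
  have hvw := @hpos 0 1 1 (by norm_num)
  have huvw := @hpos 1 1 1 (by norm_num)
  simp only [one_smul, zero_smul, add_zero, zero_add] at hu hv hw huv hvw huvw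
  fin_cases i <;> fin_cases j <;> assumption

theorem tabD_pos (h : LinearIndependent ℝ ![u, v, w]) (i : Fin 5) : 0 < tabD u v w i := by
  have hpair {A B : E3} (hAB : ∀ a b : ℝ, a • A + b • B = 0 → a = 0 ∧ b = 0) :
      0 < ‖A‖ ^ 2 * ‖B‖ ^ 2 - ⟪A, B⟫ ^ 2 :=
    norm_sq_mul_norm_sq_sub_inner_sq_pos (LinearIndependent.pair_iff.2 hAB)
  have hcoeff {x y z : ℝ} := eq_zero_of_smul_add_smul_add_smul_eq_zero h (a := x) (b := y) (c := z)
  have huv : 0 < ‖u‖ ^ 2 * ‖v‖ ^ 2 - ⟪u, v⟫ ^ 2 := hpair fun a b hab => by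
    obtain ⟨ha, hb, -⟩ := @hcoeff a b 0 (by rw [← hab]; module)
    exact ⟨ha, hb⟩
  have hvw : 0 < ‖v‖ ^ 2 * ‖w‖ ^ 2 - ⟪v, w⟫ ^ 2 := hpair fun a b hab => by
    obtain ⟨-, ha, hb⟩ := @hcoeff 0 a b (by rw [← hab]; module)
    exact ⟨ha, hb⟩
  have hsw : 0 < ‖u + v‖ ^ 2 * ‖w‖ ^ 2 - ⟪u + v, w⟫ ^ 2 := hpair fun a b hab => by
    obtain ⟨ha, -, hb⟩ := @hcoeff a a b (by rw [← hab]; module)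
    exact ⟨ha, hb⟩
  have hru : 0 < ‖u‖ ^ 2 * ‖v + w‖ ^ 2 - ⟪v + w, u⟫ ^ 2 := by
    rw [real_inner_comm]
    exact hpair fun a b hab => by
      obtain ⟨ha, hb, -⟩ := @hcoeff a b b (by rw [← hab]; module)
      exact ⟨ha, hb⟩
  fin_cases i <;> assumption

variable (c₀ c₁ c₂ : ℝ)

theorem edgeParams_Q (h : LinearIndependent ℝ ![u, v, w]) (i : Fin 5) (j : Fin 2) (η : ℝ) :
    (edgeParams u v w c₀ c₁ c₂ i j).Q η =
      ‖(![0, edgeStep η i] j : ℝ) • edgeDir u v w i + edgeBase u v w η i‖ ^ 2 := by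
  have hq := (tabQ_pos h i j).ne'
  rw [← tabQ_quadratic_eq]
  simp only [Params.Q, Params.Qm, edgeParams]
  field_simp

theorem edgeParams_d_mul_Dm (h : LinearIndependent ℝ ![u, v, w]) (i : Fin 5) (j : Fin 2)
    (η : ℝ) :
    (edgeParams u v w c₀ c₁ c₂ i j).d * (edgeParams u v w c₀ c₁ c₂ i j).Dm η =
      ‖edgeDir u v w i‖ ^ 2 * ‖edgeBase u v w η i‖ ^ 2
        - ⟪edgeDir u v w i, edgeBase u v w η i⟫ ^ 2 := by
  have hd := (tabD_pos h i).ne'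
  rw [← tabD_quadratic_eq]
  simp only [Params.Dm, edgeParams]
  field_simp

theorem edgeParams_Qm_pos (h : LinearIndependent ℝ ![u, v, w]) (i : Fin 5) (j : Fin 2) (η : ℝ) :
    0 < (edgeParams u v w c₀ c₁ c₂ i j).Qm η := by
  have hQ : 0 < (edgeParams u v w c₀ c₁ c₂ i j).Q η := by
    have hne := smul_add_ne_zero (linearIndependent_edgeDir_edgeBase h i η) (![0, edgeStep η i] j)
    rw [edgeParams_Q c₀ c₁ c₂ h]
    positivity
  exact pos_of_mul_pos_right hQ (tabQ_pos h i j).le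

theorem edgeParams_Dm_pos (h : LinearIndependent ℝ ![u, v, w]) (i : Fin 5) (j : Fin 2) (η : ℝ) :
    0 < (edgeParams u v w c₀ c₁ c₂ i j).Dm η := by
  refine pos_of_mul_pos_right ?_ (tabD_pos h i).le
  exact (edgeParams_d_mul_Dm c₀ c₁ c₂ h i j η).symm ▸
    norm_sq_mul_norm_sq_sub_inner_sq_pos (linearIndependent_edgeDir_edgeBase h i η)

theorem edgeParams_h (h : LinearIndependent ℝ ![u, v, w]) (i : Fin 5) (j : Fin 2) (η : ℝ) :
    (edgeParams u v w c₀ c₁ c₂ i j).h η =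
      linePrimitive (edgeDir u v w i) (edgeBase u v w η i) (edgeConst c₀ c₂ η i)
        (edgeSlope c₀ c₁ c₂ η i) (![0, edgeStep η i] j) := by
  rw [Params.h, edgeParams_P, edgeParams_Q c₀ c₁ c₂ h, Real.sqrt_sq (norm_nonneg _), Params.D,
    mul_assoc 4, edgeParams_d_mul_Dm c₀ c₁ c₂ h, mul_assoc 4, mul_div_mul_left _ _ four_ne_zero,
    linePrimitive]

theorem integral_edgeIntegrand_slice (h : LinearIndependent ℝ ![u, v, w]) (i : Fin 5) (η : ℝ) :
    ∫ t in (0 : ℝ)..1, edgeIntegrand u v w c₀ c₁ c₂ i (η, t) =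
      (edgeParams u v w c₀ c₁ c₂ i 1).h η - (edgeParams u v w c₀ c₁ c₂ i 0).h η := by
  simp_rw [edgeIntegrand_eq]
  rw [integral_line (linearIndependent_edgeDir_edgeBase h i η), edgeParams_h c₀ c₁ c₂ h,
    edgeParams_h c₀ c₁ c₂ h]
  rfl

variable {c₀ c₁ c₂}

theorem continuous_edgeParams_h (h : LinearIndependent ℝ ![u, v, w]) (i : Fin 5) (j : Fin 2) :
    Continuous (edgeParams u v w c₀ c₁ c₂ i j).h :=
  Params.continuous_h (tabQ_pos h i j).le (tabD_pos h i).ne'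
    (edgeParams_Qm_pos c₀ c₁ c₂ h i j) (edgeParams_Dm_pos c₀ c₁ c₂ h i j)

theorem edgeIntegral_eq_integral_sub_integral (h : LinearIndependent ℝ ![u, v, w]) {i : Fin 5}
    (hint : IntegrableOn (edgeIntegrand u v w c₀ c₁ c₂ i) (Ioo (0 : ℝ) 1 ×ˢ Ioo (0 : ℝ) 1)) :
    edgeIntegral u v w c₀ c₁ c₂ i =
      (∫ η in (0 : ℝ)..1, (edgeParams u v w c₀ c₁ c₂ i 1).h η)
        - ∫ η in (0 : ℝ)..1, (edgeParams u v w c₀ c₁ c₂ i 0).h η := by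
  have hh (j : Fin 2) := (continuous_edgeParams_h (c₀ := c₀) (c₁ := c₁) (c₂ := c₂) h i
    j).intervalIntegrable (μ := volume) 0 1
  rw [edgeIntegral, Measure.volume_eq_prod, setIntegral_prod _ hint,
    ← intervalIntegral.integral_sub (hh 1) (hh 0)]
  simp only [← integral_edgeIntegrand_slice c₀ c₁ c₂ h,
    intervalIntegral.integral_of_le zero_le_one, integral_Ioc_eq_integral_Ioo]

end Slices

/-! ### Fibrewise changes of variables -/

section Fiberwise

variable {α β γ : Type*} [MeasurableSpace α] [MeasurableSpace β] [MeasurableSpace γ]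

theorem lintegral_fiberwise {μ : Measure α} {ν : Measure β} [SFinite μ] [SFinite ν] {s : Set α}
    {t : α → Set β} (ht : MeasurableSet {z : α × β | z.2 ∈ t z.1}) {f : α × β → ℝ≥0∞}
    (hf : Measurable f) :
    ∫⁻ z in {z | z.1 ∈ s ∧ z.2 ∈ t z.1}, f z ∂μ.prod ν =
      ∫⁻ x in s, ∫⁻ y in t x, f (x, y) ∂ν ∂μ := by
  have hrestrict : (μ.prod ν).restrict {z | z.1 ∈ s ∧ z.2 ∈ t z.1} =
      ((μ.restrict s).prod ν).restrict {z | z.2 ∈ t z.1} := by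
    rw [← Measure.restrict_univ (μ := ν), Measure.prod_restrict, Measure.restrict_restrict ht,
      Measure.restrict_univ]
    congr 1
    ext z
    simp [and_comm]
  rw [hrestrict, ← lintegral_indicator ht, lintegral_prod _ (hf.indicator ht).aemeasurable]
  refine lintegral_congr fun x => ?_
  exact lintegral_indicator (measurable_prodMk_left ht) _

theorem measurePreserving_withDensity_of_lintegral {μ : Measure α} {ν : Measure β} {f : α → β}
    {ρ : α → ℝ≥0∞} (hf : Measurable f) (hρ : Measurable ρ)
    (h : ∀ g : β → ℝ≥0∞, Measurable g → ∫⁻ y, g y ∂ν = ∫⁻ x, ρ x * g (f x) ∂μ) :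
    MeasurePreserving f (μ.withDensity ρ) ν := by
  refine ⟨hf, Measure.ext_of_lintegral _ fun g hg => ?_⟩
  rw [lintegral_map hg hf, h g hg]
  exact lintegral_withDensity_eq_lintegral_mul _ hρ (hg.comp hf)

theorem measurePreserving_fiberwise {μ : Measure α} {ν : Measure β} {κ : Measure γ} [SFinite μ]
    [SFinite ν] [SFinite κ] {s : Set α} {t : Set β} {W : α → Set γ} {g : α × β → γ}
    {ρ : α × β → ℝ≥0∞} (hs : MeasurableSet s) (hW : MeasurableSet {z : α × γ | z.2 ∈ W z.1})
    (hg : Measurable g) (hρ : Measurable ρ)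
    (h : ∀ x ∈ s, MeasurePreserving (fun y => g (x, y))
      ((ν.restrict t).withDensity fun y => ρ (x, y)) (κ.restrict (W x))) :
    MeasurePreserving (fun z => (z.1, g z)) (((μ.prod ν).restrict (s ×ˢ t)).withDensity ρ)
      ((μ.prod κ).restrict {z | z.1 ∈ s ∧ z.2 ∈ W z.1}) := by
  have hm : Measurable fun z : α × β => (z.1, g z) := measurable_fst.prodMk hg
  refine measurePreserving_withDensity_of_lintegral hm hρ fun f hf => ?_
  rw [lintegral_fiberwise hW hf, ← Measure.prod_restrict, lintegral_prod _ (by fun_prop)]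
  refine setLIntegral_congr_fun hs fun x hx => ?_
  have hfx : Measurable fun y => f (x, y) := hf.comp measurable_prodMk_left
  simp only
  rw [← (h x hx).lintegral_comp hfx]
  exact lintegral_withDensity_eq_lintegral_mul _ (hρ.comp measurable_prodMk_left)
    (hfx.comp (h x hx).measurable)

theorem measurePreserving_comp_restrict {μ : Measure α} {ν : Measure β} {κ : Measure γ}
    {s : Set β} {t : Set γ} {f : α → β} {g : β → γ} (hf : MeasurePreserving f μ (ν.restrict s))
    (hg : MeasurePreserving g ν κ) (ht : MeasurableSet t) (hs : g ⁻¹' t = s) :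
    MeasurePreserving (g ∘ f) μ (κ.restrict t) :=
  (hs ▸ hg.restrict_preimage ht).comp hf

section Density

variable {E : Type*} [NormedAddCommGroup E] [NormedSpace ℝ E] {μ : Measure α} {ν : Measure β}
  {s : Set α} {f : α → β} {ρ : α → ℝ} {g : β → E}

theorem integrable_iff_of_measurePreserving_withDensity
    (hf : MeasurePreserving f ((μ.restrict s).withDensity fun x => ENNReal.ofReal (ρ x)) ν)
    (hs : MeasurableSet s) (hρ : Measurable ρ) (hρs : ∀ x ∈ s, 0 ≤ ρ x)
    (hg : AEStronglyMeasurable g ν) :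
    Integrable g ν ↔ IntegrableOn (fun x => ρ x • g (f x)) s μ := by
  rw [← hf.integrable_comp hg, integrable_withDensity_iff_integrable_smul' hρ.ennreal_ofReal
    (Eventually.of_forall fun _ => ENNReal.ofReal_lt_top)]
  refine integrable_congr ((ae_restrict_mem hs).mono fun x hx => ?_)
  simp only [Function.comp, ENNReal.toReal_ofReal (hρs x hx)]

theorem integral_eq_of_measurePreserving_withDensity
    (hf : MeasurePreserving f ((μ.restrict s).withDensity fun x => ENNReal.ofReal (ρ x)) ν)
    (hs : MeasurableSet s) (hρ : Measurable ρ) (hρs : ∀ x ∈ s, 0 ≤ ρ x)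
    (hg : AEStronglyMeasurable g ν) :
    ∫ y, g y ∂ν = ∫ x in s, ρ x • g (f x) ∂μ := by
  rw [← hf.map_eq, integral_map hf.measurable.aemeasurable (hf.map_eq ▸ hg),
    integral_withDensity_eq_integral_toReal_smul hρ.ennreal_ofReal
      (Eventually.of_forall fun _ => ENNReal.ofReal_lt_top)]
  refine setIntegral_congr_fun hs fun x hx => ?_
  simp only [ENNReal.toReal_ofReal (hρs x hx)]

end Density

end Fiberwise

/-! ### The Duffy transformation -/

/-- The open unit square, the common domain of the regularised integrals. -/
def unitSquare : Set (ℝ × ℝ) := Ioo (0 : ℝ) 1 ×ˢ Ioo (0 : ℝ) 1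

/-- The reference triangle scaled by the factor `a`. -/
def scaledTriangle (a : ℝ) : Set (ℝ × ℝ) := {z | z.1 ∈ Ioo 0 a ∧ z.2 ∈ Ioo 0 z.1}

theorem measurableSet_unitSquare : MeasurableSet unitSquare :=
  measurableSet_Ioo.prod measurableSet_Ioo

theorem measurableSet_refTriangle : MeasurableSet refTriangle := by
  unfold refTriangle
  measurability

theorem scaledTriangle_one : scaledTriangle 1 = refTriangle := by
  ext z
  simp only [scaledTriangle, refTriangle, mem_Ioo, mem_ofPred_eq]
  tauto

theorem lintegral_Ioo_scale {c : ℝ} (hc : 0 < c) (g : ℝ → ℝ≥0∞) :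
    ∫⁻ x in Ioo 0 c, g x = ∫⁻ s in Ioo (0 : ℝ) 1, ENNReal.ofReal c * g (c * s) := by
  have h := lintegral_image_eq_lintegral_abs_deriv_mul (f := fun s => c * s) (f' := fun _ => c)
    (s := Ioo (0 : ℝ) 1) measurableSet_Ioo
    (fun x _ => by simpa using ((hasDerivAt_id x).const_mul c).hasDerivWithinAt)
    (mul_right_injective₀ hc.ne').injOn g
  rwa [image_mul_left_Ioo hc, mul_zero, mul_one, abs_of_pos hc] at h

theorem measurePreserving_duffy {a : ℝ} (ha : 0 < a) :
    MeasurePreserving (fun η : ℝ × ℝ => (a * η.1, a * η.1 * η.2))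
      ((volume.restrict unitSquare).withDensity fun η => ENNReal.ofReal (a ^ 2 * η.1))
      (volume.restrict (scaledTriangle a)) := by
  refine measurePreserving_withDensity_of_lintegral (by fun_prop) (by fun_prop) fun g hg => ?_
  rw [unitSquare, Measure.volume_eq_prod, ← Measure.prod_restrict, lintegral_prod _ (by fun_prop),
    scaledTriangle, lintegral_fiberwise (by simp only [mem_Ioo]; measurability) hg,
    lintegral_Ioo_scale ha]
  refine setLIntegral_congr_fun measurableSet_Ioo fun s hs => ?_
  rw [lintegral_Ioo_scale (mul_pos ha hs.1), ← lintegral_const_mul _ (by fun_prop)]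
  refine lintegral_congr fun q => ?_
  rw [← mul_assoc, ← ENNReal.ofReal_mul ha.le, ← mul_assoc, sq]

theorem measurePreserving_scaleSquare {a : ℝ} (ha : 0 < a) :
    MeasurePreserving (fun η : ℝ × ℝ => (a * η.1, a * η.2))
      ((volume.restrict unitSquare).withDensity fun _ => ENNReal.ofReal (a ^ 2))
      (volume.restrict (Ioo 0 a ×ˢ Ioo 0 a)) := by
  refine measurePreserving_withDensity_of_lintegral (by fun_prop) (by fun_prop) fun g hg => ?_
  rw [unitSquare, Measure.volume_eq_prod, ← Measure.prod_restrict, ← Measure.prod_restrict,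
    lintegral_prod _ hg.aemeasurable, lintegral_prod _ (by fun_prop), lintegral_Ioo_scale ha]
  refine lintegral_congr fun s => ?_
  rw [lintegral_Ioo_scale ha, ← lintegral_const_mul _ (by fun_prop)]
  refine lintegral_congr fun q => ?_
  rw [← mul_assoc, ← ENNReal.ofReal_mul ha.le, sq]

theorem integral_refTriangle_eq_integral_duffy {g : ℝ × ℝ → ℝ} (hg : Measurable g) :
    ∫ x in refTriangle, g x = ∫ η in unitSquare, η.1 * g (η.1, η.1 * η.2) := by
  have h := integral_eq_of_measurePreserving_withDensity (measurePreserving_duffy one_pos)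
    measurableSet_unitSquare (by fun_prop)
    (fun η hη => mul_nonneg (by positivity) hη.1.1.le) hg.aestronglyMeasurable
  simpa only [scaledTriangle_one, one_pow, one_mul, smul_eq_mul] using h

theorem integral_unitSquare_mul (f g : ℝ → ℝ) :
    ∫ η in unitSquare, f η.1 * g η.2 = (∫ x in (0 : ℝ)..1, f x) * ∫ y in (0 : ℝ)..1, g y := by
  rw [unitSquare, Measure.volume_eq_prod, setIntegral_prod_mul,
    intervalIntegral.integral_of_le zero_le_one, intervalIntegral.integral_of_le zero_le_one,
    integral_Ioc_eq_integral_Ioo, integral_Ioc_eq_integral_Ioo]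

theorem integral_refTriangle_affine (a₀ a₁ : ℝ) :
    ∫ x in refTriangle, (a₀ + a₁ * x.1) = a₀ / 2 + a₁ / 3 := by
  rw [integral_refTriangle_eq_integral_duffy (by fun_prop)]
  have h := integral_unitSquare_mul (fun x => x * (a₀ + a₁ * x)) fun _ => 1
  simp only [mul_one] at h
  rw [h]
  simp only [mul_add, mul_left_comm _ a₁, ← sq]
  rw [intervalIntegral.integral_add (Continuous.intervalIntegrable (by fun_prop) _ _)
    (Continuous.intervalIntegrable (by fun_prop) _ _), intervalIntegral.integral_mul_const,
    intervalIntegral.integral_const_mul, integral_id, integral_pow,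
    intervalIntegral.integral_const]
  norm_num
  ring

theorem integral_refTriangle_snd : ∫ x in refTriangle, x.2 = 1 / 6 := by
  rw [integral_refTriangle_eq_integral_duffy (by fun_prop)]
  have h := integral_unitSquare_mul (fun x => x ^ 2) fun y => y
  rw [integral_id, integral_pow] at h
  simp only [← mul_assoc, ← sq]
  rw [h]
  norm_num

/-! ### Relative coordinates on pairs of reference triangles -/

theorem measurePreserving_duffy_fiberwise :
    MeasurePreserving
      (fun z : (ℝ × ℝ) × (ℝ × ℝ) => (z.1, (z.1.2 * z.2.1, z.1.2 * z.2.1 * z.2.2)))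
      ((volume.restrict (refTriangle ×ˢ unitSquare)).withDensity
        fun z => ENNReal.ofReal (z.1.2 ^ 2 * z.2.1))
      (volume.restrict {z | z.1 ∈ refTriangle ∧ z.2 ∈ scaledTriangle z.1.2}) :=
  measurePreserving_fiberwise
    (g := fun z : (ℝ × ℝ) × (ℝ × ℝ) => (z.1.2 * z.2.1, z.1.2 * z.2.1 * z.2.2))
    (W := fun x => scaledTriangle x.2) measurableSet_refTriangle
    (by simp only [scaledTriangle, mem_Ioo, mem_ofPred_eq]; measurability) (by fun_prop)
    (by fun_prop) fun _ hx => measurePreserving_duffy hx.2.2.1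

theorem measurePreserving_scaleSquare_fiberwise :
    MeasurePreserving (fun z : (ℝ × ℝ) × (ℝ × ℝ) => (z.1, (z.1.2 * z.2.1, z.1.2 * z.2.2)))
      ((volume.restrict (refTriangle ×ˢ unitSquare)).withDensity
        fun z => ENNReal.ofReal (z.1.2 ^ 2))
      (volume.restrict {z | z.1 ∈ refTriangle ∧ z.2 ∈ Ioo 0 z.1.2 ×ˢ Ioo 0 z.1.2}) :=
  measurePreserving_fiberwise
    (g := fun z : (ℝ × ℝ) × (ℝ × ℝ) => (z.1.2 * z.2.1, z.1.2 * z.2.2))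
    (W := fun x => Ioo 0 x.2 ×ˢ Ioo 0 x.2) measurableSet_refTriangle
    (by simp only [mem_prod, mem_Ioo]; measurability) (by fun_prop)
    (by fun_prop) fun _ hx => measurePreserving_scaleSquare hx.2.2.1

theorem measurePreserving_sub_snd_sub_snd (Y : ℝ) :
    MeasurePreserving (fun z : ℝ × ℝ => (Y - z.2, z.1 - z.2)) volume volume :=
  ((Measure.measurePreserving_sub_left volume Y).prod (MeasurePreserving.id volume)).comp
    (Measure.measurePreserving_swap.comp (measurePreserving_sub_prod volume volume))

theorem measurePreserving_shearSnd :
    MeasurePreserving (fun z : (ℝ × ℝ) × (ℝ × ℝ) => (z.1, (z.1.1 - z.2.2, z.2.1 - z.2.2)))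
      volume volume :=
  (MeasurePreserving.id volume).skew_product (g := fun (x z : ℝ × ℝ) => (x.1 - z.2, z.1 - z.2))
    (by fun_prop) (Eventually.of_forall fun x => (measurePreserving_sub_snd_sub_snd x.1).map_eq)

theorem measurePreserving_swap_pair :
    MeasurePreserving (Prod.swap : (ℝ × ℝ) × (ℝ × ℝ) → (ℝ × ℝ) × (ℝ × ℝ)) volume volume :=
  Measure.measurePreserving_swap

theorem measurePreserving_swapSnd :
    MeasurePreserving (fun z : (ℝ × ℝ) × (ℝ × ℝ) => (z.1, z.2.swap)) volume volume :=
  (MeasurePreserving.id volume).prod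
    (Measure.measurePreserving_swap (μ := (volume : Measure ℝ)) (ν := (volume : Measure ℝ)))

theorem measurePreserving_rotate :
    MeasurePreserving (fun z : (ℝ × ℝ) × (ℝ × ℝ) => ((z.1.1, z.2.2), (z.1.2, z.2.1)))
      volume volume := by
  have hassoc : MeasurePreserving (MeasurableEquiv.prodAssoc : (ℝ × ℝ) × (ℝ × ℝ) ≃ᵐ _)
      volume volume := volume_preserving_prodAssoc
  have hassoc' : MeasurePreserving (MeasurableEquiv.prodAssoc : (ℝ × ℝ) × ℝ ≃ᵐ _)
      volume volume := volume_preserving_prodAssoc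
  have hswap : MeasurePreserving (Prod.swap : (ℝ × ℝ) × ℝ → ℝ × (ℝ × ℝ)) volume volume :=
    Measure.measurePreserving_swap
  exact hassoc.symm.comp
    (((MeasurePreserving.id (volume : Measure ℝ)).prod (hswap.comp hassoc'.symm)).comp hassoc)

theorem measurePreserving_shearFst :
    MeasurePreserving (fun z : (ℝ × ℝ) × (ℝ × ℝ) =>
      ((z.1.1 - z.2.1, z.1.2 - z.2.1), (z.1.1, z.2.2))) volume volume :=
  measurePreserving_swap_pair.comp (measurePreserving_shearSnd.comp measurePreserving_rotate)

/-- The five parts into which the signs of `x₁ - y₁`, `x₂ - y₂ - (x₁ - y₁)` and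
`y₂ + (x₁ - y₁)` split the pairs `z = (x, y)` of points of the reference triangle. -/
def edgeRegion (i : Fin 5) : Set ((ℝ × ℝ) × (ℝ × ℝ)) :=
  {z | z ∈ refTriangle ×ˢ refTriangle ∧
    ![z.2.1 < z.1.1 ∧ z.1.2 < z.2.2 + (z.1.1 - z.2.1),
      z.2.1 < z.1.1 ∧ z.2.2 + (z.1.1 - z.2.1) < z.1.2,
      z.1.1 < z.2.1 ∧ z.1.2 + (z.2.1 - z.1.1) < z.2.2,
      z.1.1 < z.2.1 ∧ z.2.2 < z.2.1 - z.1.1,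
      z.1.1 < z.2.1 ∧ z.2.1 - z.1.1 < z.2.2 ∧ z.2.2 < z.1.2 + (z.2.1 - z.1.1)] i}

/-- Parametrisations of the five parts `edgeRegion i` by `((ξ, a), (η₃, η₄))`, where `(ξ, a)` runs
over the reference triangle and `(η₃, η₄)` over the unit square. The difference of the
two charts at a pair of points is `a` times a vector depending on `(η₃, η₄)` only. -/
def edgeMap : Fin 5 → (ℝ × ℝ) × (ℝ × ℝ) → (ℝ × ℝ) × (ℝ × ℝ) :=
  ![fun z => ((z.1.1, z.1.2 * z.2.2), (z.1.1 - z.1.2 * z.2.1, z.1.2 - z.1.2 * z.2.1)),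
    fun z => (z.1, (z.1.1 - z.1.2 * z.2.1 * z.2.2, z.1.2 * z.2.1 - z.1.2 * z.2.1 * z.2.2)),
    fun z => ((z.1.1 - z.1.2 * z.2.1 * z.2.2, z.1.2 * z.2.1 - z.1.2 * z.2.1 * z.2.2), z.1),
    fun z => ((z.1.1 - z.1.2 * z.2.1, z.1.2 - z.1.2 * z.2.1), (z.1.1, z.1.2 * z.2.1 * z.2.2)),
    fun z => ((z.1.1 - z.1.2 * z.2.1 * z.2.2, z.1.2 - z.1.2 * z.2.1 * z.2.2),
      (z.1.1, z.1.2 * z.2.1))]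

/-- The Jacobians of the parametrisations `edgeMap i`. -/
def edgeJac : Fin 5 → (ℝ × ℝ) × (ℝ × ℝ) → ℝ :=
  ![fun z => z.1.2 ^ 2, fun z => z.1.2 ^ 2 * z.2.1, fun z => z.1.2 ^ 2 * z.2.1,
    fun z => z.1.2 ^ 2 * z.2.1, fun z => z.1.2 ^ 2 * z.2.1]

theorem measurableSet_edgeRegion (i : Fin 5) : MeasurableSet (edgeRegion i) := by
  fin_cases i <;> simp only [edgeRegion, refTriangle, mem_prod, mem_ofPred_eq, Fin.zero_eta,
    Fin.mk_one, Fin.reduceFinMk, Matrix.cons_val] <;> measurability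

theorem measurable_edgeJac (i : Fin 5) : Measurable (edgeJac i) := by
  fin_cases i <;> simp only [edgeJac, Fin.zero_eta, Fin.mk_one, Fin.reduceFinMk,
    Matrix.cons_val] <;> fun_prop

theorem edgeJac_nonneg (i : Fin 5) {z : (ℝ × ℝ) × (ℝ × ℝ)}
    (hz : z ∈ refTriangle ×ˢ unitSquare) : 0 ≤ edgeJac i z := by
  have hη : 0 ≤ z.2.1 := hz.2.1.1.le
  fin_cases i <;> simp only [edgeJac, Fin.zero_eta, Fin.mk_one, Fin.reduceFinMk,
    Matrix.cons_val] <;> positivity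

theorem measurePreserving_edgeMap (i : Fin 5) :
    MeasurePreserving (edgeMap i)
      ((volume.restrict (refTriangle ×ˢ unitSquare)).withDensity
        fun z => ENNReal.ofReal (edgeJac i z))
      (volume.restrict (edgeRegion i)) := by
  have hm := measurableSet_edgeRegion
  match i with
  | 0 =>
    exact (measurePreserving_comp_restrict measurePreserving_scaleSquare_fiberwise
        (measurePreserving_swap_pair.comp measurePreserving_shearFst) (hm 0) (by
          ext z
          simp only [edgeRegion, refTriangle, Function.comp, Prod.swap, mem_prod, mem_Ioo,
            mem_preimage, mem_ofPred_eq, Matrix.cons_val]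
          grind) :)
  | 1 =>
    exact (measurePreserving_comp_restrict measurePreserving_duffy_fiberwise
        measurePreserving_shearSnd (hm 1) (by
          ext z
          simp only [edgeRegion, refTriangle, scaledTriangle, mem_prod, mem_Ioo,
            mem_preimage, mem_ofPred_eq, Matrix.cons_val]
          grind) :)
  | 2 =>
    exact (measurePreserving_comp_restrict measurePreserving_duffy_fiberwise
        (measurePreserving_swap_pair.comp measurePreserving_shearSnd) (hm 2) (by
          ext z
          simp only [edgeRegion, refTriangle, scaledTriangle, Function.comp, Prod.swap, mem_prod,
            mem_Ioo, mem_preimage, mem_ofPred_eq, Matrix.cons_val]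
          grind) :)
  | 3 =>
    exact (measurePreserving_comp_restrict measurePreserving_duffy_fiberwise
        measurePreserving_shearFst (hm 3) (by
          ext z
          simp only [edgeRegion, refTriangle, scaledTriangle, mem_prod, mem_Ioo,
            mem_preimage, mem_ofPred_eq, Matrix.cons_val]
          grind) :)
  | 4 =>
    exact (measurePreserving_comp_restrict measurePreserving_duffy_fiberwise
        (measurePreserving_shearFst.comp measurePreserving_swapSnd) (hm 4) (by
          ext z
          simp only [edgeRegion, refTriangle, scaledTriangle, Function.comp, Prod.swap, mem_prod,
            mem_Ioo, mem_preimage, mem_ofPred_eq, Matrix.cons_val]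
          grind) :)

theorem pairwise_disjoint_edgeRegion : Pairwise (Function.onFun Disjoint edgeRegion) := by
  intro i j hij
  rw [Function.onFun, Set.disjoint_left]
  intro z hi hj
  fin_cases i <;> fin_cases j <;>
    simp only [edgeRegion, refTriangle, mem_prod, Fin.zero_eta, Fin.mk_one, Fin.reduceFinMk,
      Matrix.cons_val, mem_ofPred_eq, ne_eq, not_true_eq_false] at hi hj hij <;>
    linarith

theorem ae_linearMap_ne_zero {l : (ℝ × ℝ) × (ℝ × ℝ) →ₗ[ℝ] ℝ} (hl : l ≠ 0) :
    ∀ᵐ z : (ℝ × ℝ) × (ℝ × ℝ), l z ≠ 0 :=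
  have : (volume : Measure ((ℝ × ℝ) × (ℝ × ℝ))).IsAddHaarMeasure :=
    inferInstanceAs ((volume : Measure (ℝ × ℝ)).prod (volume : Measure (ℝ × ℝ))).IsAddHaarMeasure
  measure_eq_zero_iff_ae_notMem.1
    (Measure.addHaar_submodule volume (LinearMap.ker l) fun h => hl (LinearMap.ker_eq_top.1 h))

theorem exists_mem_edgeRegion {z : (ℝ × ℝ) × (ℝ × ℝ)} (hz : z ∈ refTriangle ×ˢ refTriangle)
    (hfst : z.1.1 ≠ z.2.1) (hdiff : z.1.2 - z.2.2 ≠ z.1.1 - z.2.1)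
    (hsnd : z.2.2 ≠ z.2.1 - z.1.1) : ∃ i, z ∈ edgeRegion i := by
  by_contra! hcon
  have h₀ := hcon 0
  have h₁ := hcon 1
  have h₂ := hcon 2
  have h₃ := hcon 3
  have h₄ := hcon 4
  simp only [edgeRegion, Matrix.cons_val, mem_ofPred_eq, hz, true_and] at h₀ h₁ h₂ h₃ h₄
  grind

theorem iUnion_edgeRegion_ae_eq :
    (⋃ i, edgeRegion i : Set ((ℝ × ℝ) × (ℝ × ℝ))) =ᵐ[volume] refTriangle ×ˢ refTriangle := by
  let x₁ : (ℝ × ℝ) × (ℝ × ℝ) →ₗ[ℝ] ℝ := LinearMap.fst ℝ ℝ ℝ ∘ₗ LinearMap.fst ℝ _ _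
  let x₂ : (ℝ × ℝ) × (ℝ × ℝ) →ₗ[ℝ] ℝ := LinearMap.snd ℝ ℝ ℝ ∘ₗ LinearMap.fst ℝ _ _
  let y₁ : (ℝ × ℝ) × (ℝ × ℝ) →ₗ[ℝ] ℝ := LinearMap.fst ℝ ℝ ℝ ∘ₗ LinearMap.snd ℝ _ _
  let y₂ : (ℝ × ℝ) × (ℝ × ℝ) →ₗ[ℝ] ℝ := LinearMap.snd ℝ ℝ ℝ ∘ₗ LinearMap.snd ℝ _ _
  have hne (l : (ℝ × ℝ) × (ℝ × ℝ) →ₗ[ℝ] ℝ) (hl : l ((1, 0), (0, 0)) ≠ 0) : l ≠ 0 := by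
    rintro rfl
    exact hl rfl
  have hfst := ae_linearMap_ne_zero (hne (x₁ - y₁) (by simp [x₁, y₁]))
  have hdiff := ae_linearMap_ne_zero (hne (x₂ - y₂ - (x₁ - y₁)) (by simp [x₁, x₂, y₁, y₂]))
  have hsnd := ae_linearMap_ne_zero (hne (y₂ - (y₁ - x₁)) (by simp [x₁, y₁, y₂]))
  filter_upwards [hfst, hdiff, hsnd] with z hfst hdiff hsnd
  exact propext ⟨fun hz => (mem_iUnion.1 hz).elim fun _ hi => hi.1, fun hz =>
    mem_iUnion.2 (exists_mem_edgeRegion hz (sub_ne_zero.1 hfst) (sub_ne_zero.1 hdiff)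
      (sub_ne_zero.1 hsnd))⟩

theorem restrict_refTriangle_prod :
    (volume : Measure ((ℝ × ℝ) × (ℝ × ℝ))).restrict (refTriangle ×ˢ refTriangle) =
      ∑ i, volume.restrict (edgeRegion i) := by
  rw [← Measure.restrict_congr_set iUnion_edgeRegion_ae_eq,
    Measure.restrict_iUnion pairwise_disjoint_edgeRegion measurableSet_edgeRegion,
    Measure.sum_fintype]

section RefTriangleProd

variable {f : (ℝ × ℝ) × (ℝ × ℝ) → ℝ} (hf : Measurable f)
  (h : ∀ i, IntegrableOn (fun z => edgeJac i z * f (edgeMap i z)) (refTriangle ×ˢ unitSquare))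
include hf h

theorem integrableOn_edgeRegion (i : Fin 5) : IntegrableOn f (edgeRegion i) :=
  (integrable_iff_of_measurePreserving_withDensity (measurePreserving_edgeMap i)
    (measurableSet_refTriangle.prod measurableSet_unitSquare) (measurable_edgeJac i)
    (fun _ => edgeJac_nonneg i) hf.aestronglyMeasurable).2 (h i)

theorem integrableOn_refTriangle_prod : IntegrableOn f (refTriangle ×ˢ refTriangle) := by
  rw [IntegrableOn, restrict_refTriangle_prod, integrable_finsetSum_measure]
  exact fun i _ => integrableOn_edgeRegion hf h i

theorem integral_refTriangle_prod :
    ∫ z in refTriangle ×ˢ refTriangle, f z =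
      ∑ i, ∫ z in refTriangle ×ˢ unitSquare, edgeJac i z * f (edgeMap i z) := by
  rw [restrict_refTriangle_prod,
    integral_finsetSum_measure fun i _ => integrableOn_edgeRegion hf h i]
  exact Finset.sum_congr rfl fun i _ => integral_eq_of_measurePreserving_withDensity
    (measurePreserving_edgeMap i) (measurableSet_refTriangle.prod measurableSet_unitSquare)
    (measurable_edgeJac i) (fun _ => edgeJac_nonneg i) hf.aestronglyMeasurable

end RefTriangleProd

/-! ### Integrating out the outer variables -/

theorem edgeIntegrand_eq_add (u v w : E3) (c₀ c₁ c₂ : ℝ) (i : Fin 5) (η : ℝ × ℝ) :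
    edgeIntegrand u v w c₀ c₁ c₂ i η = c₀ * edgeIntegrand u v w 1 0 0 i η
      + c₁ * edgeIntegrand u v w 0 1 0 i η + c₂ * edgeIntegrand u v w 0 0 1 i η := by
  fin_cases i <;> simp only [edgeIntegrand, Fin.zero_eta, Fin.mk_one, Fin.reduceFinMk,
    Matrix.cons_val] <;> ring

theorem integral_add_add {α : Type*} [MeasurableSpace α] {μ : Measure α} {f g h : α → ℝ}
    (hf : Integrable f μ) (hg : Integrable g μ) (hh : Integrable h μ) :
    ∫ x, (f x + g x + h x) ∂μ = ∫ x, f x ∂μ + ∫ x, g x ∂μ + ∫ x, h x ∂μ := by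
  rw [← integral_add hf hg]
  exact integral_add (hf.add hg) hh

section Average

variable {α : Type*} [MeasurableSpace α] {μ : Measure α} {f₀ f₁ f₂ : α → ℝ}
  {u v w : E3} {i : Fin 5}

theorem integrable_edgeIntegrand_prod (h₀ : Integrable f₀ μ) (h₁ : Integrable f₁ μ)
    (h₂ : Integrable f₂ μ)
    (hint : ∀ c₀ c₁ c₂, IntegrableOn (edgeIntegrand u v w c₀ c₁ c₂ i) unitSquare) :
    Integrable (fun z : α × (ℝ × ℝ) => edgeIntegrand u v w (f₀ z.1) (f₁ z.1) (f₂ z.1) i z.2)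
      (μ.prod (volume.restrict unitSquare)) := by
  simp only [fun z : α × (ℝ × ℝ) => edgeIntegrand_eq_add u v w (f₀ z.1) (f₁ z.1) (f₂ z.1) i z.2]
  exact ((h₀.mul_prod (hint 1 0 0)).add (h₁.mul_prod (hint 0 1 0))).add
    (h₂.mul_prod (hint 0 0 1))

theorem integral_edgeIntegrand_prod [SFinite μ] (h₀ : Integrable f₀ μ) (h₁ : Integrable f₁ μ)
    (h₂ : Integrable f₂ μ)
    (hint : ∀ c₀ c₁ c₂, IntegrableOn (edgeIntegrand u v w c₀ c₁ c₂ i) unitSquare) :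
    ∫ z, edgeIntegrand u v w (f₀ z.1) (f₁ z.1) (f₂ z.1) i z.2
        ∂(μ.prod (volume.restrict unitSquare)) =
      edgeIntegral u v w (∫ x, f₀ x ∂μ) (∫ x, f₁ x ∂μ) (∫ x, f₂ x ∂μ) i := by
  rw [integral_prod _ (integrable_edgeIntegrand_prod h₀ h₁ h₂ hint)]
  have hslice (c₀ c₁ c₂ : ℝ) : edgeIntegral u v w c₀ c₁ c₂ i = c₀ * edgeIntegral u v w 1 0 0 i
      + c₁ * edgeIntegral u v w 0 1 0 i + c₂ * edgeIntegral u v w 0 0 1 i := by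
    simp only [edgeIntegral, edgeIntegrand_eq_add u v w c₀ c₁ c₂]
    refine (integral_add_add ((hint 1 0 0).const_mul c₀) ((hint 0 1 0).const_mul c₁)
      ((hint 0 0 1).const_mul c₂)).trans ?_
    rw [integral_const_mul, integral_const_mul, integral_const_mul, unitSquare]
  calc ∫ x, edgeIntegral u v w (f₀ x) (f₁ x) (f₂ x) i ∂μ
    _ = ∫ x, (f₀ x * edgeIntegral u v w 1 0 0 i + f₁ x * edgeIntegral u v w 0 1 0 i
          + f₂ x * edgeIntegral u v w 0 0 1 i) ∂μ := by simp only [← hslice]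
    _ = _ := by
      rw [integral_add_add (h₀.mul_const _) (h₁.mul_const _) (h₂.mul_const _),
        integral_mul_const, integral_mul_const, integral_mul_const, hslice (∫ x, f₀ x ∂μ)]

end Average

/-- The double layer integrand in the reference coordinates `z = (x, y)` of the two triangles,
up to a constant factor. -/
def refIntegrand (u v w : E3) (a₀ a₁ a₂ : ℝ) (z : (ℝ × ℝ) × (ℝ × ℝ)) : ℝ :=
  z.1.2 / ‖(z.1.1 - z.2.1) • v + z.1.2 • w - z.2.2 • u‖ ^ 3 * (a₀ + a₁ * z.2.1 + a₂ * z.2.2)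

theorem measurable_refIntegrand (u v w : E3) (a₀ a₁ a₂ : ℝ) :
    Measurable (refIntegrand u v w a₀ a₁ a₂) := by
  unfold refIntegrand
  exact ((by fun_prop : Measurable fun z : (ℝ × ℝ) × (ℝ × ℝ) => z.1.2).div
    (Continuous.measurable (by fun_prop))).mul (by fun_prop)

theorem sq_mul_div_norm_smul_cube {V : Type*} [NormedAddCommGroup V] [NormedSpace ℝ V] {a : ℝ}
    (ha : 0 < a) (b : ℝ) (x : V) : a ^ 2 * (a * b / ‖a • x‖ ^ 3) = b / ‖x‖ ^ 3 := by
  rw [norm_smul, Real.norm_of_nonneg ha.le, mul_pow, mul_div_assoc', ← mul_assoc, ← pow_succ]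
  exact mul_div_mul_left _ _ (by positivity)

theorem edgeJac_mul_refIntegrand (u v w : E3) (a₀ a₁ a₂ : ℝ) (i : Fin 5)
    {z : (ℝ × ℝ) × (ℝ × ℝ)} (ha : 0 < z.1.2) :
    edgeJac i z * refIntegrand u v w a₀ a₁ a₂ (edgeMap i z) =
      edgeIntegrand u v w (a₀ + a₁ * z.1.1) (-a₁ * z.1.2) (a₂ * z.1.2) i z.2 := by
  obtain ⟨⟨ξ, a⟩, ⟨s, t⟩⟩ := z
  match i with
  | 0 =>
    simp only [edgeJac, refIntegrand, edgeMap, edgeIntegrand, Matrix.cons_val]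
    rw [show (ξ - (ξ - a * s)) • v + (a * t) • w - (a - a * s) • u
      = a • (s • (u + v) + t • w - u) by module,
      ← sq_mul_div_norm_smul_cube ha t]
    ring
  | 1 =>
    simp only [edgeJac, refIntegrand, edgeMap, edgeIntegrand, Matrix.cons_val]
    rw [show (ξ - (ξ - a * s * t)) • v + a • w - (a * s - a * s * t) • u
      = a • ((s * t) • (u + v) - s • u + w) by module,
      ← sq_mul_div_norm_smul_cube ha s]
    ring
  | 2 =>
    simp only [edgeJac, refIntegrand, edgeMap, edgeIntegrand, Matrix.cons_val]
    rw [← norm_neg ((_ : ℝ) • v + _ - _),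
      show -((ξ - a * s * t - ξ) • v + (a * s - a * s * t) • w - a • u)
        = a • ((s * t) • (w + v) - s • w + u) by module,
      ← sq_mul_div_norm_smul_cube ha (s ^ 2 * (1 - t))]
    ring
  | 3 =>
    simp only [edgeJac, refIntegrand, edgeMap, edgeIntegrand, Matrix.cons_val]
    rw [← norm_neg ((_ : ℝ) • v + _ - _),
      show -((ξ - a * s - ξ) • v + (a - a * s) • w - (a * s * t) • u)
        = a • ((s * t) • u + s • (w + v) - w) by module,
      ← sq_mul_div_norm_smul_cube ha (s * (1 - s))]
    ring
  | 4 =>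
    simp only [edgeJac, refIntegrand, edgeMap, edgeIntegrand, Matrix.cons_val]
    rw [← norm_neg ((_ : ℝ) • v + _ - _),
      show -((ξ - a * s * t - ξ) • v + (a - a * s * t) • w - (a * s) • u)
        = a • ((s * t) • (w + v) + s • u - w) by module,
      ← sq_mul_div_norm_smul_cube ha (s * (1 - s * t))]
    ring

theorem integrableOn_refTriangle {f : ℝ × ℝ → ℝ} (hf : Continuous f) :
    IntegrableOn f refTriangle :=
  (hf.continuousOn.integrableOn_compact (isCompact_Icc.prod isCompact_Icc)).mono_set
    (t := Icc (0 : ℝ) 1 ×ˢ Icc (0 : ℝ) 1)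
    fun _ hx => ⟨⟨hx.1.le, hx.2.1.le⟩, ⟨hx.2.2.1.le, (hx.2.2.2.trans hx.2.1).le⟩⟩

section RefIntegrand

variable {u v w : E3}
  (hint : ∀ i c₀ c₁ c₂, IntegrableOn (edgeIntegrand u v w c₀ c₁ c₂ i) unitSquare)
  (a₀ a₁ a₂ : ℝ)
include hint

theorem integrableOn_edgeJac_mul_refIntegrand (i : Fin 5) :
    IntegrableOn (fun z => edgeJac i z * refIntegrand u v w a₀ a₁ a₂ (edgeMap i z))
      (refTriangle ×ˢ unitSquare) := by
  have h := integrable_edgeIntegrand_prod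
    (integrableOn_refTriangle (f := fun x => a₀ + a₁ * x.1) (by fun_prop))
    (integrableOn_refTriangle (f := fun x => -a₁ * x.2) (by fun_prop))
    (integrableOn_refTriangle (f := fun x => a₂ * x.2) (by fun_prop)) (hint i)
  rw [Measure.prod_restrict] at h
  exact IntegrableOn.congr_fun h
    (fun z hz => (edgeJac_mul_refIntegrand u v w a₀ a₁ a₂ i hz.1.2.2.1).symm)
    (measurableSet_refTriangle.prod measurableSet_unitSquare)

theorem integral_edgeJac_mul_refIntegrand (i : Fin 5) :
    ∫ z in refTriangle ×ˢ unitSquare, edgeJac i z * refIntegrand u v w a₀ a₁ a₂ (edgeMap i z) =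
      edgeIntegral u v w (a₀ / 2 + a₁ / 3) (-a₁ / 6) (a₂ / 6) i := by
  have h := integral_edgeIntegrand_prod
    (integrableOn_refTriangle (f := fun x => a₀ + a₁ * x.1) (by fun_prop))
    (integrableOn_refTriangle (f := fun x => -a₁ * x.2) (by fun_prop))
    (integrableOn_refTriangle (f := fun x => a₂ * x.2) (by fun_prop)) (hint i)
  rw [Measure.prod_restrict, integral_const_mul, integral_const_mul, integral_refTriangle_affine,
    integral_refTriangle_snd, mul_one_div, mul_one_div] at h
  rw [← h]
  exact setIntegral_congr_fun (measurableSet_refTriangle.prod measurableSet_unitSquare)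
    fun z hz => edgeJac_mul_refIntegrand u v w a₀ a₁ a₂ i hz.1.2.2.1

theorem integrableOn_refIntegrand :
    IntegrableOn (refIntegrand u v w a₀ a₁ a₂) (refTriangle ×ˢ refTriangle) :=
  integrableOn_refTriangle_prod (measurable_refIntegrand u v w a₀ a₁ a₂)
    (integrableOn_edgeJac_mul_refIntegrand hint a₀ a₁ a₂)

theorem integral_refIntegrand :
    ∫ z in refTriangle ×ˢ refTriangle, refIntegrand u v w a₀ a₁ a₂ z =
      ∑ i, edgeIntegral u v w (a₀ / 2 + a₁ / 3) (-a₁ / 6) (a₂ / 6) i := by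
  rw [integral_refTriangle_prod (measurable_refIntegrand u v w a₀ a₁ a₂)
    (integrableOn_edgeJac_mul_refIntegrand hint a₀ a₁ a₂)]
  exact Finset.sum_congr rfl fun i _ => integral_edgeJac_mul_refIntegrand hint a₀ a₁ a₂ i

end RefIntegrand

/-! ### Triangles meeting in an edge -/

theorem gramDet_nonneg (a b : E3) : 0 ≤ gramDet a b :=
  Real.sqrt_nonneg _

theorem linearIndependent_of_gramDet_ne_zero {a b : E3} (h : gramDet a b ≠ 0) :
    LinearIndependent ℝ ![a, b] :=
  Matrix.det_gram_ne_zero_iff_linearIndependent.1 fun h₀ => h (by rw [gramDet, h₀, Real.sqrt_zero])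

theorem linearIndependent_of_orthogonal_of_inner_ne_zero {V : Type*} [NormedAddCommGroup V]
    [InnerProductSpace ℝ V] {u v w n : V} (h : LinearIndependent ℝ ![v, u]) (hv : ⟪v, n⟫ = 0)
    (hu : ⟪u, n⟫ = 0) (hw : ⟪w, n⟫ ≠ 0) : LinearIndependent ℝ ![u, v, w] := by
  refine Fintype.linearIndependent_iff.2 fun g hg => ?_
  simp only [Fin.sum_univ_three, Matrix.cons_val] at hg
  have hg₂ : g 2 = 0 := by
    have hinner : ⟪g 0 • u + g 1 • v + g 2 • w, n⟫ = 0 := by rw [hg, inner_zero_left]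
    rw [inner_add_left, inner_add_left, real_inner_smul_left, real_inner_smul_left,
      real_inner_smul_left, hv, hu, mul_zero, mul_zero, zero_add, zero_add] at hinner
    exact (mul_eq_zero.1 hinner).resolve_right hw
  rw [hg₂, zero_smul, add_zero, add_comm] at hg
  obtain ⟨hg₁, hg₀⟩ := LinearIndependent.pair_iff.1 h _ _ hg
  exact Fin.forall_fin_succ.2 ⟨hg₀, Fin.forall_fin_two.2 ⟨hg₁, hg₂⟩⟩

/-- The half-planes `ℝ v + ℝ≥0 w` and `ℝ v + ℝ≥0 u` meet only in the line `ℝ v`, and all three of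
these sets are nondegenerate. Near interior points of the common edge, this says that the two
triangles meet only in that edge. -/
def MeetOnlyInEdge (u v w : E3) : Prop :=
  ∀ z α β : ℝ, 0 ≤ α → 0 ≤ β → z • v + α • w - β • u = 0 → z = 0 ∧ α = 0 ∧ β = 0

theorem mem_closure_triangle (p a b : E3) {x y : ℝ} (hx : 0 < x) (hx₁ : x < 1) (hy : 0 ≤ y)
    (hyx : y ≤ x) : p + x • a + y • b ∈ closure (triangle p a b) := by
  have hy' : y ∈ closure (Ioo 0 x) := by
    rw [closure_Ioo hx.ne]
    exact ⟨hy, hyx⟩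
  exact map_mem_closure (f := fun y : ℝ => p + x • a + y • b) (by fun_prop) hy'
    fun z hz => ⟨(x, z), ⟨hx, hx₁, hz.1, hz.2⟩, rfl⟩

theorem exists_pos_abs_mul_lt {δ : ℝ} (hδ : 0 < δ) (x y z : ℝ) :
    ∃ ε > 0, |ε * x| < δ ∧ |ε * y| < δ ∧ |ε * z| < δ := by
  have hlim (x : ℝ) : ∀ᶠ ε : ℝ in 𝓝[>] 0, |ε * x| < δ :=
    nhdsWithin_le_nhds <| (by fun_prop : Continuous fun ε : ℝ => |ε * x|).continuousAt.eventually_lt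
      continuousAt_const (by simpa only [zero_mul, abs_zero] using hδ)
  exact (eventually_mem_nhdsWithin.and ((hlim x).and ((hlim y).and (hlim z)))).exists

theorem meetOnlyInEdge_of_closure_inter_closure {p u v w : E3} (hu : LinearIndependent ℝ ![v, u])
    (hw : LinearIndependent ℝ ![v, w])
    (hedge : closure (triangle p v w) ∩ closure (triangle p v u) ⊆ segment ℝ p (p + v)) :
    MeetOnlyInEdge u v w := by
  intro z α β hα hβ h
  obtain ⟨ε, hε, hz, hεα, hεβ⟩ := exists_pos_abs_mul_lt (δ := 1 / 4) (by norm_num) z α β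
  rw [abs_lt] at hz hεα hεβ
  have hσ : p + (1 / 2 + ε * z) • v + (ε * α) • w ∈ closure (triangle p v w) :=
    mem_closure_triangle p v w (by linarith) (by linarith) (by positivity) (by linarith)
  have hτ : p + (1 / 2 : ℝ) • v + (ε * β) • u ∈ closure (triangle p v u) :=
    mem_closure_triangle p v u (by norm_num) (by norm_num) (by positivity) (by linarith)
  have hpoint : p + (1 / 2 + ε * z) • v + (ε * α) • w = p + (1 / 2 : ℝ) • v + (ε * β) • u := by
    rw [← sub_eq_zero]
    calc _ = ε • (z • v + α • w - β • u) := by module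
      _ = 0 := by rw [h, smul_zero]
  have hmem := hedge ⟨hpoint ▸ hσ, hτ⟩
  rw [segment_eq_image'] at hmem
  obtain ⟨θ, -, hθ⟩ := hmem
  have hline : (1 / 2 - θ) • v + (ε * β) • u = 0 := by
    rw [← sub_eq_zero.2 hθ.symm]
    module
  have hβ₀ : β = 0 := (mul_eq_zero.1 (LinearIndependent.pair_iff.1 hu _ _ hline).2).resolve_left
    hε.ne'
  rw [hβ₀, zero_smul, sub_zero] at h
  obtain ⟨hz₀, hα₀⟩ := LinearIndependent.pair_iff.1 hw _ _ h
  exact ⟨hz₀, hα₀, hβ₀⟩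

theorem MeetOnlyInEdge.continuousOn_edgeIntegrand {u v w : E3} (h : MeetOnlyInEdge u v w)
    (i : Fin 5) (c₀ c₁ c₂ : ℝ) :
    ContinuousOn (edgeIntegrand u v w c₀ c₁ c₂ i) (Icc (0 : ℝ) 1 ×ˢ Icc (0 : ℝ) 1) := by
  fin_cases i
  all_goals
    refine ContinuousOn.mul (ContinuousOn.div (by fun_prop) (by fun_prop) ?_) (by fun_prop)
    rintro ⟨s, t⟩ ⟨⟨hs₀ : 0 ≤ s, hs₁ : s ≤ 1⟩, ⟨ht₀ : 0 ≤ t, ht₁ : t ≤ 1⟩⟩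
    have hst₀ : 0 ≤ s * t := mul_nonneg hs₀ ht₀
    have hst₁ : s * t ≤ s := mul_le_of_le_one_right hs₀ ht₁
    refine pow_ne_zero 3 (norm_ne_zero_iff.2 fun h₀ => ?_)
    simp only at h₀
  · obtain ⟨hs, -, hs'⟩ := h s t (1 - s) ht₀ (by linarith) (by rw [← h₀]; module)
    linarith
  · exact one_ne_zero (h (s * t) 1 (s - s * t) zero_le_one (by linarith)
      (by rw [← h₀]; module)).2.1
  · exact one_ne_zero (h (-(s * t)) (s - s * t) 1 (by linarith) zero_le_one
      (by rw [← neg_zero, ← h₀]; module)).2.2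
  · obtain ⟨hs, hs', -⟩ := h (-s) (1 - s) (s * t) (by linarith) hst₀
      (by rw [← neg_zero, ← h₀]; module)
    linarith
  · obtain ⟨hst, hst', -⟩ := h (-(s * t)) (1 - s * t) s (by linarith) hs₀
      (by rw [← neg_zero, ← h₀]; module)
    linarith

theorem MeetOnlyInEdge.integrableOn_edgeIntegrand {u v w : E3} (h : MeetOnlyInEdge u v w)
    (i : Fin 5) (c₀ c₁ c₂ : ℝ) : IntegrableOn (edgeIntegrand u v w c₀ c₁ c₂ i) unitSquare :=
  ((h.continuousOn_edgeIntegrand i c₀ c₁ c₂).integrableOn_compact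
    (isCompact_Icc.prod isCompact_Icc)).mono_set (prod_mono Ioo_subset_Icc_self Ioo_subset_Icc_self)

/-! ### Surface integrals over flat triangles -/

/-- The linear part of `chart`, on the Euclidean plane rather than on `ℝ × ℝ`, which carries the
sup norm, so that `LinearMap.normDet` is the area factor. -/
def chartLin (a b : E3) : EuclideanSpace ℝ (Fin 2) →ₗ[ℝ] E3 where
  toFun x := x 0 • a + x 1 • b
  map_add' x y := by
    simp only [PiLp.add_apply]
    module
  map_smul' c x := by
    simp only [PiLp.smul_apply, smul_eq_mul, RingHom.id_apply]
    module

theorem normDet_chartLin (a b : E3) : (chartLin a b).normDet = gramDet a b := by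
  have hbasis : (fun i => chartLin a b (EuclideanSpace.basisFun (Fin 2) ℝ i)) = ![a, b] := by
    ext i; fin_cases i <;> simp [chartLin]
  have hsq : (chartLin a b).normDet ^ 2 = (Matrix.gram ℝ ![a, b]).det := by
    rw [← hbasis]
    simpa using LinearMap.normDet_sq_eq_det_gram (chartLin a b)
      (EuclideanSpace.basisFun (Fin 2) ℝ)
  rw [gramDet, ← hsq, Real.sqrt_sq (LinearMap.normDet_nonneg _)]

/-- The measure preserving identification of `ℝ × ℝ` with the Euclidean plane. -/
def planeEquiv : ℝ × ℝ ≃ᵐ EuclideanSpace ℝ (Fin 2) :=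
  (MeasurableEquiv.finTwoArrow (α := ℝ)).symm.trans (MeasurableEquiv.toLp 2 (Fin 2 → ℝ))

theorem measurePreserving_planeEquiv : MeasurePreserving planeEquiv volume volume :=
  (volume_preserving_finTwoArrow ℝ).symm.trans (PiLp.volume_preserving_toLp (Fin 2))

theorem chart_eq_add_chartLin (p a b : E3) (x : ℝ × ℝ) :
    chart p a b x = p + chartLin a b (planeEquiv x) :=
  add_assoc _ _ _

theorem continuous_chart (p a b : E3) : Continuous (chart p a b) := by
  unfold chart
  fun_prop

theorem measurableEmbedding_chart (p : E3) {a b : E3} (h : LinearIndependent ℝ ![a, b]) :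
    MeasurableEmbedding (chart p a b) := by
  refine (continuous_chart p a b).measurableEmbedding fun x y hxy => ?_
  have hdiff : (x.1 - y.1) • a + (x.2 - y.2) • b = 0 := by
    rw [← sub_eq_zero.2 hxy, chart, chart]
    module
  obtain ⟨h₁, h₂⟩ := LinearIndependent.pair_iff.1 h _ _ hdiff
  exact Prod.ext (sub_eq_zero.1 h₁) (sub_eq_zero.1 h₂)

theorem euclideanHausdorffMeasure_image_chart (p a b : E3) (s : Set (ℝ × ℝ)) :
    μHE[2] (chart p a b '' s) = ENNReal.ofReal (gramDet a b) * volume s := by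
  have hlin := LinearMap.euclideanHausdorffMeasure_image_eq_normDet_mul_volume
    (chartLin a b) (planeEquiv '' s)
  rw [finrank_euclideanSpace_fin, normDet_chartLin, planeEquiv.image_eq_preimage_symm,
    measurePreserving_planeEquiv.symm.measure_preimage_equiv,
    ← planeEquiv.image_eq_preimage_symm] at hlin
  have himage : chart p a b '' s = (fun y => p + y) '' (chartLin a b '' (planeEquiv '' s)) := by
    simp only [image_image, chart_eq_add_chartLin]
  rw [himage, ← hlin]
  exact (IsometryEquiv.addLeft p).isometry.euclideanHausdorffMeasure_image _

theorem restrict_triangle (p a b : E3) :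
    (μHE[2] : Measure E3).restrict (triangle p a b) =
      ENNReal.ofReal (gramDet a b) • (volume.restrict refTriangle).map (chart p a b) := by
  ext E hE
  rw [Measure.restrict_apply hE, Measure.smul_apply, smul_eq_mul,
    Measure.map_apply (continuous_chart p a b).measurable hE,
    Measure.restrict_apply ((continuous_chart p a b).measurable hE), triangle,
    inter_comm, ← image_inter_preimage, euclideanHausdorffMeasure_image_chart, inter_comm]

theorem restrict_triangle_prod (p a b c : E3) :
    ((μHE[2] : Measure E3).restrict (triangle p a b)).prod
        ((μHE[2] : Measure E3).restrict (triangle p a c)) =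
      (ENNReal.ofReal (gramDet a b) * ENNReal.ofReal (gramDet a c)) •
        (volume.restrict (refTriangle ×ˢ refTriangle)).map
          (Prod.map (chart p a b) (chart p a c)) := by
  rw [restrict_triangle, restrict_triangle, Measure.prod_smul_left, Measure.prod_smul_right,
    smul_smul, Measure.map_prod_map _ _ (continuous_chart p a b).measurable
      (continuous_chart p a c).measurable, Measure.prod_restrict, ← Measure.volume_eq_prod]

instance sFinite_restrict_triangle (p a b : E3) :
    SFinite ((μHE[2] : Measure E3).restrict (triangle p a b)) := by
  rw [restrict_triangle]
  infer_instance

theorem kernel_chart_mul {p u v w n : E3} {φ : E3 → ℝ} {a₀ a₁ a₂ : ℝ} (hnv : ⟪v, n⟫ = 0)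
    (hnu : ⟪u, n⟫ = 0)
    (hφ : ∀ y ∈ refTriangle, φ (chart p v u y) = a₀ + a₁ * y.1 + a₂ * y.2)
    {z : (ℝ × ℝ) × (ℝ × ℝ)} (hz : z ∈ refTriangle ×ˢ refTriangle) :
    kernel n (chart p v w z.1) (chart p v u z.2) * φ (chart p v u z.2) =
      ⟪w, n⟫ / (4 * Real.pi) * refIntegrand u v w a₀ a₁ a₂ z := by
  have hdiff : chart p v w z.1 - chart p v u z.2
      = (z.1.1 - z.2.1) • v + z.1.2 • w - z.2.2 • u := by
    rw [chart, chart]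
    module
  rw [hφ _ hz.2, kernel, hdiff, refIntegrand, inner_sub_left, inner_add_left,
    real_inner_smul_left, real_inner_smul_left, real_inner_smul_left, hnv, hnu]
  ring

section DoubleLayerIntegral

variable {p u v w n : E3} {φ : E3 → ℝ} {a₀ a₁ a₂ : ℝ}
  (hu : LinearIndependent ℝ ![v, u]) (hw : LinearIndependent ℝ ![v, w])
  (hint : ∀ i c₀ c₁ c₂, IntegrableOn (edgeIntegrand u v w c₀ c₁ c₂ i) unitSquare)
  (hnv : ⟪v, n⟫ = 0) (hnu : ⟪u, n⟫ = 0)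
  (hφ : ∀ y ∈ refTriangle, φ (chart p v u y) = a₀ + a₁ * y.1 + a₂ * y.2)
include hu hw hint hnv hnu hφ

theorem integrable_kernel_mul :
    Integrable (fun z : E3 × E3 => kernel n z.1 z.2 * φ z.2)
      (((μHE[2] : Measure E3).restrict (triangle p v w)).prod
        ((μHE[2] : Measure E3).restrict (triangle p v u))) := by
  rw [restrict_triangle_prod]
  refine Integrable.smul_measure ?_ (ENNReal.mul_ne_top ENNReal.ofReal_ne_top
    ENNReal.ofReal_ne_top)
  rw [((measurableEmbedding_chart p hw).prodMap
    (measurableEmbedding_chart p hu)).integrable_map_iff]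
  exact IntegrableOn.congr_fun ((integrableOn_refIntegrand hint a₀ a₁ a₂).const_mul _)
    (fun z hz => (kernel_chart_mul hnv hnu hφ hz).symm)
    (measurableSet_refTriangle.prod measurableSet_refTriangle)

theorem doubleLayerIntegral_eq :
    doubleLayerIntegral (triangle p v w) (triangle p v u) n φ =
      gramDet v w * gramDet v u / (4 * Real.pi) * ⟪w, n⟫ *
        ∑ i, edgeIntegral u v w (a₀ / 2 + a₁ / 3) (-a₁ / 6) (a₂ / 6) i := by
  have href : ∫ z in refTriangle ×ˢ refTriangle,
      kernel n (chart p v w z.1) (chart p v u z.2) * φ (chart p v u z.2) =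
        ⟪w, n⟫ / (4 * Real.pi) *
          ∑ i, edgeIntegral u v w (a₀ / 2 + a₁ / 3) (-a₁ / 6) (a₂ / 6) i := by
    rw [← integral_refIntegrand hint, ← integral_const_mul]
    exact setIntegral_congr_fun (measurableSet_refTriangle.prod measurableSet_refTriangle)
      fun z hz => kernel_chart_mul hnv hnu hφ hz
  rw [doubleLayerIntegral, ← integral_prod _ (integrable_kernel_mul hu hw hint hnv hnu hφ),
    restrict_triangle_prod, integral_smul_measure, ((measurableEmbedding_chart p hw).prodMap
      (measurableEmbedding_chart p hu)).integral_map]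
  simp only [Prod.map_fst, Prod.map_snd]
  rw [href, ENNReal.toReal_mul, ENNReal.toReal_ofReal (gramDet_nonneg _ _),
    ENNReal.toReal_ofReal (gramDet_nonneg _ _), smul_eq_mul]
  ring

end DoubleLayerIntegral

end DoubleLayer

end

theorem mainTheorem3
    (p u v w n : DoubleLayer.E3) (φ : DoubleLayer.E3 → ℝ) (a₀ a₁ a₂ c₀ c₁ c₂ : ℝ)
    (σ τ : Set DoubleLayer.E3)
    (hτ : τ = DoubleLayer.triangle p v u) (hσ : σ = DoubleLayer.triangle p v w)
    (hgτ : DoubleLayer.gramDet v u ≠ 0) (hgσ : DoubleLayer.gramDet v w ≠ 0)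
    (hedge : closure σ ∩ closure τ = segment ℝ p (p + v))
    (hn : ‖n‖ = 1) (hnv : ⟪v, n⟫ = 0) (hnu : ⟪u, n⟫ = 0)
    (hφ : ∀ y ∈ DoubleLayer.refTriangle,
      φ (DoubleLayer.chart p v u y) = a₀ + a₁ * y.1 + a₂ * y.2)
    (hc₀ : c₀ = a₀ / 2 + a₁ / 3) (hc₁ : c₁ = -a₁ / 6) (hc₂ : c₂ = a₂ / 6) :
    -- all integrals in the first formula converge absolutely
    Integrable (fun z : DoubleLayer.E3 × DoubleLayer.E3 =>
        DoubleLayer.kernel n z.1 z.2 * φ z.2)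
      (((μHE[2] : Measure DoubleLayer.E3).restrict σ).prod
        ((μHE[2] : Measure DoubleLayer.E3).restrict τ)) ∧
    (∀ i, IntegrableOn (DoubleLayer.edgeIntegrand u v w c₀ c₁ c₂ i)
      (Ioo (0 : ℝ) 1 ×ˢ Ioo (0 : ℝ) 1)) ∧
    DoubleLayer.doubleLayerIntegral σ τ n φ =
      DoubleLayer.gramDet v w * DoubleLayer.gramDet v u / (4 * Real.pi) * ⟪w, n⟫ *
        ∑ i, DoubleLayer.edgeIntegral u v w c₀ c₁ c₂ i ∧
    -- for triangles in one plane the integral vanishes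
    (⟪w, n⟫ = 0 → DoubleLayer.doubleLayerIntegral σ τ n φ = 0) ∧
    -- otherwise every integral is a difference of two explicit one-dimensional integrals
    (⟪w, n⟫ ≠ 0 →
      (∀ i, ∀ η₃ ∈ Icc (0 : ℝ) 1,
        ∫ η₄ in (0 : ℝ)..1, DoubleLayer.edgeIntegrand u v w c₀ c₁ c₂ i (η₃, η₄) =
          (DoubleLayer.edgeParams u v w c₀ c₁ c₂ i 1).h η₃
            - (DoubleLayer.edgeParams u v w c₀ c₁ c₂ i 0).h η₃) ∧
      (∀ i, DoubleLayer.edgeIntegral u v w c₀ c₁ c₂ i =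
        (∫ η in (0 : ℝ)..1, (DoubleLayer.edgeParams u v w c₀ c₁ c₂ i 1).h η)
          - ∫ η in (0 : ℝ)..1, (DoubleLayer.edgeParams u v w c₀ c₁ c₂ i 0).h η) ∧
      -- and these are evaluated in closed form
      ∀ (i : Fin 5) (j : Fin 2) (S : DoubleLayer.Params),
        S = DoubleLayer.edgeParams u v w c₀ c₁ c₂ i j →
        0 < S.q ∧ 0 < S.d ∧ (∀ η, 0 < S.Q η) ∧ (∀ η, 0 < S.D η) ∧
        IntervalIntegrable S.h volume 0 1 ∧
        -- partial fractions
        (∀ η, S.h η = 1 / (S.d * √(S.Q η)) *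
          (S.p₂ - S.d₁ * S.p₃ + S.p₃ * η + (S.n + S.m * η) / S.Dm η)) ∧
        -- the fractional linear substitution
        (S.d₁ ≠ S.q₁ → ∃ ν μ : ℝ, ν < μ ∧
          (∀ z : ℝ, (S.d₁ - S.q₁) * z ^ 2 + 2 * (S.d₀ - S.q₀) * z
              + (S.q₁ * S.d₀ - S.d₁ * S.q₀) = 0 ↔ z = ν ∨ z = μ) ∧
          (∀ η, η ≠ μ → HasDerivAt (fun x => S.H ν μ (DoubleLayer.subst ν μ x))
            ((S.n + S.m * η) / (S.Dm η * √(S.Qm η))) η) ∧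
          Tendsto (S.H ν μ) atTop (𝓝 (S.HTop ν μ)) ∧
          Tendsto (S.H ν μ) atBot (𝓝 (S.HBot ν μ)) ∧
          (μ ≠ 0 → μ ≠ 1 → ∀ t₀ t₁ : ℝ,
            t₀ = min (-ν / μ) (-(ν - 1) / (μ - 1)) →
            t₁ = max (-ν / μ) (-(ν - 1) / (μ - 1)) →
            ((-1 < t₀ ∨ t₁ < -1) ∧
              ∫ η in (0 : ℝ)..1, S.h η =
                1 / (S.d * √S.q) * (S.E 1 - S.E 0 + (S.H ν μ t₁ - S.H ν μ t₀))) ∨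
            ((t₀ < -1 ∧ -1 < t₁) ∧
              ∫ η in (0 : ℝ)..1, S.h η =
                1 / (S.d * √S.q) * (S.E 1 - S.E 0 +
                  (S.H ν μ t₀ - S.HBot ν μ + S.HTop ν μ - S.H ν μ t₁)))) ∧
          (μ = 0 → ∫ η in (0 : ℝ)..1, S.h η =
            1 / (S.d * √S.q) * (S.E 1 - S.E 0 + (S.H ν μ (ν - 1) - S.HBot ν μ))) ∧
          (μ = 1 → ∫ η in (0 : ℝ)..1, S.h η =
            1 / (S.d * √S.q) * (S.E 1 - S.E 0 + (S.HTop ν μ - S.H ν μ (-ν))))) ∧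
        -- the substitution degenerates to a shift
        (S.d₁ = S.q₁ → S.d₀ ≠ S.q₀ → ∫ η in (0 : ℝ)..1, S.h η =
          1 / (S.d * √S.q) * (S.E 1 - S.E 0 +
            (S.HShift (1 + S.q₁ / 2) - S.HShift (S.q₁ / 2)))) ∧
        (S.d₁ = S.q₁ → S.d₀ = S.q₀ → ∫ η in (0 : ℝ)..1, S.h η =
          1 / (S.d * √S.q) * (S.E 1 - S.E 0 +
            (S.HProp (1 + S.q₁ / 2) - S.HProp (S.q₁ / 2))))) := by
  open DoubleLayer Params in
  have hu := linearIndependent_of_gramDet_ne_zero hgτ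
  have hw := linearIndependent_of_gramDet_ne_zero hgσ
  have hint := (meetOnlyInEdge_of_closure_inter_closure hu hw
    (hσ ▸ hτ ▸ hedge).subset).integrableOn_edgeIntegrand
  have hJ := doubleLayerIntegral_eq hu hw hint hnv hnu hφ
  rw [← hσ, ← hτ, ← hc₀, ← hc₁, ← hc₂] at hJ
  refine ⟨hσ ▸ hτ ▸ integrable_kernel_mul hu hw hint hnv hnu hφ, fun i => hint i _ _ _, hJ,
    fun h₀ => by rw [hJ, h₀, mul_zero, zero_mul], fun hwn => ?_⟩
  have hli := linearIndependent_of_orthogonal_of_inner_ne_zero hu hnv hnu hwn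
  refine ⟨fun i η _ => integral_edgeIntegrand_slice _ _ _ hli i η,
    fun i => edgeIntegral_eq_integral_sub_integral hli (hint i _ _ _), ?_⟩
  rintro i j S rfl
  have hq := tabQ_pos hli i j
  have hd := tabD_pos hli i
  have hQ := edgeParams_Qm_pos c₀ c₁ c₂ hli i j
  have hD := edgeParams_Dm_pos c₀ c₁ c₂ hli i j
  have hI {T : ℝ} := integral_h_eq hq.le hd.ne' hQ hD (T := T)
  refine ⟨hq, hd, fun η => mul_pos hq (hQ η), fun η => mul_pos (mul_pos four_pos hd) (hD η),
    (continuous_edgeParams_h hli i j).intervalIntegrable _ _,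
    fun η => h_eq_partialFractions hd.ne' (hD η).ne', fun h₁ => ?_,
    fun h₁ h₀ => hI (integral_remainder_eq_HShift hQ hD h₁ h₀),
    fun h₁ h₀ => hI (integral_remainder_eq_HProp hQ hD h₁ h₀)⟩
  obtain ⟨ν, μ, hc, hroots⟩ := exists_isConjugatePair hQ h₁
  exact ⟨ν, μ, hc.lt, hroots, fun η => hc.hasDerivAt_H_subst hQ hD h₁,
    hc.tendsto_H_atTop hQ hD h₁, hc.tendsto_H_atBot hQ hD h₁,
    fun hμ₀ hμ₁ _ _ ht₀ ht₁ => (hc.integral_remainder_alternatives hQ hD h₁ hμ₀ hμ₁ ht₀ ht₁).imp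
      (And.imp_right hI) (And.imp_right hI),
    by rintro rfl; exact hI (hc.integral_remainder_of_eq_zero hQ hD h₁),
    by rintro rfl; exact hI (hc.integral_remainder_of_eq_one hQ hD h₁)⟩
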